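/- Let $G$ be a finite graph on $n\ge 2$ vertices whose edges $\{i,j\}$ carry rates $\alpha_{ij}=\alpha_{ji}\ge 0$ (put $\alpha_{ij}=0$ if $\{i,j\}$ is not an edge). The random walk jumps from vertex $i$ to vertex $j$ at rate $\alpha_{ij}$; its Laplacian is the matrix $L^{RW}$ indexed by the vertices, with $L^{RW}(i,j)=-\alpha_{ij}$ for $i\ne j$ and $L^{RW}(i,i)=\sum_{k\neq i}\alpha_{ik}$. The interchange process on the permutations of the vertices jumps from $\sigma$ to $(i\,j)\sigma$ at rate $\alpha_{ij}$ for every unordered pair $\{i,j\}$; its Laplacian is the $n!\times n!$ matrix $L^{I}$ with $L^{I}(\sigma,\sigma)=\sum_{\{i,j\}}\alpha_{ij}$, $L^{I}(\sigma,(i\,j)\sigma)=-\alpha_{ij}$, and all other entries zero. The spectral gap of either process is the second smallest eigenvalue, counted with multiplicity, of its Laplacian. We say that Aldous' conjecture holds for $G$ if, for all nonnegative rates on the edges of $G$ such that $G$ remains connected (on all of its vertices) after the edges of rate zero are removed, the spectral gap of the interchange process equals the spectral gap of the random walk. For $N\ge 1$ define graphs $T_{0,N}, T_{1,N},\dots$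 recursively. $T_{0,N}=K_3$ is the complete graph on three vertices. The graph $T_{i+1,N}$ is obtained from $T_{i,N}$ as follows: for each cycle of length 3 that is present in $T_{i,N}$ but not in $T_{i-1,N}$ (for $i=0$: for the single cycle of $K_3$), add $N$ new vertices and join each of them by an edge to each of the three vertices of that cycle. **Proposition.** For all $D\ge 0$ and $N\ge 1$, Aldous' conjecture holds for $T_{D,N}$. In particular, $T_{1,1}$ is the complete graph $K_4$, and Aldous' conjecture holds for every graph on four vertices. Moreover, every finite tree with at least two vertices is isomorphic to a (not necessarily induced) subgraph of $T_{D,N}$ for some $D\ge 0$ and $N\ge 1$, and Aldous' conjecture holds for every such tree. -/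

import Mathlib

/-- `IsRates G α`: `α i j` is the interchange rate of the edge `{i, j}` of `G`. The rates are
symmetric and nonnegative; pairs that are not edges of `G` carry rate zero. -/
structure IsRates {V : Type*} (G : SimpleGraph V) (α : V → V → ℝ) : Prop where
  symm : ∀ i j, α i j = α j i
  nonneg : ∀ i j, 0 ≤ α i j
  eq_zero_of_not_adj : ∀ i j, ¬ G.Adj i j → α i j = 0

/-- The graph that remains after the edges of rate zero are removed: distinct `i`, `j` are adjacent
when their rate is positive. -/
def positiveRateGraph {V : Type*} (α : V → V → ℝ) : SimpleGraph V :=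
  SimpleGraph.fromRel fun i j => 0 < α i j

/-- The Laplacian of the random walk (minus the intensity matrix of the continuous-time chain that
jumps from `i` to `j` at rate `α i j`). -/
def randomWalkLaplacian {V : Type*} [Fintype V] [DecidableEq V] (α : V → V → ℝ) :
    Matrix V V ℝ :=
  Matrix.of fun i j => if i = j then ∑ k with k ≠ i, α i k else -α i j

/-- The Laplacian of the interchange process (minus the intensity matrix of the continuous-time
chain on permutations that jumps from `σ` to `(i j) σ` at rate `α i j`, for every unordered pair
`{i, j}` of distinct vertices). Both sums run over ordered pairs, hence the factor `1 / 2`: the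
diagonal entry is the sum of all rates, and the entry at `(σ, (i j) σ)` is `-α i j`. -/
noncomputable def interchangeLaplacian {V : Type*} [Fintype V] [DecidableEq V] (α : V → V → ℝ) :
    Matrix (Equiv.Perm V) (Equiv.Perm V) ℝ :=
  Matrix.of fun σ τ =>
    if σ = τ then (1 / 2) * ∑ i, ∑ j with j ≠ i, α i j
    else -((1 / 2) * ∑ i, ∑ j with j ≠ i, if τ = Equiv.swap i j * σ then α i j else 0)

/-- The second smallest eigenvalue, counted with multiplicity, of a real matrix all of whose
eigenvalues are real: the entry at position `1` (counting from `0`) of the increasing list of the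
roots of the characteristic polynomial. It is meaningful for symmetric matrices of size at least
two. For a Laplacian this is minus the second largest eigenvalue of the intensity matrix, that is,
the spectral gap. -/
noncomputable def secondSmallestEigenvalue {n : Type*} [Fintype n] [DecidableEq n]
    (A : Matrix n n ℝ) : ℝ :=
  (A.charpoly.roots.sort (· ≤ ·)).getD 1 0

/-- Aldous' conjecture holds for the graph `G` with arbitrary nonnegative rates that leave it
connected: the spectral gaps of the interchange process and of the random walk are equal. -/
def AldousHolds {V : Type*} [Fintype V] [DecidableEq V] (G : SimpleGraph V) : Prop :=
  ∀ α : V → V → ℝ, IsRates G α → (positiveRateGraph α).Connected →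
    secondSmallestEigenvalue (interchangeLaplacian α) =
      secondSmallestEigenvalue (randomWalkLaplacian α)

/-- A stage of the construction of the graphs with nested triangulations: the current graph and,
on the same vertex type, the graph of the preceding stage (its later vertices being isolated). -/
structure NestedStage where
  /-- the vertices of the current graph -/
  V : Type
  /-- the current graph -/
  graph : SimpleGraph V
  /-- the graph of the preceding stage -/
  prev : SimpleGraph V

/-- The vertex sets of the cycles of length three that are present in the current graph but not in
the preceding one. -/
def NestedStage.NewTriangle (S : NestedStage) : Type :=
  {s : Finset S.V // S.graph.IsNClique 3 s ∧ ¬ S.prev.IsNClique 3 s}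

/-- For every new triangle, add `N` vertices and join each of them to the three vertices of the
triangle. -/
def NestedStage.next (N : ℕ) (S : NestedStage) : NestedStage where
  V := S.V ⊕ (S.NewTriangle × Fin N)
  graph :=
    { Adj := fun x y =>
        match x, y with
        | Sum.inl a, Sum.inl b => S.graph.Adj a b
        | Sum.inl a, Sum.inr t => a ∈ t.1.1
        | Sum.inr t, Sum.inl b => b ∈ t.1.1
        | Sum.inr _, Sum.inr _ => False
      symm := ⟨by
        rintro (a | t) (b | u) h
        · exact S.graph.adj_symm h
        · exact h
        · exact h
        · exact h⟩
      loopless := ⟨by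
        rintro (a | t) h
        · exact S.graph.loopless.irrefl a h
        · exact h⟩ }
  prev := S.graph.map Function.Embedding.inl

/-- The stages for branching parameter `N`. The first one is the complete graph on three vertices,
with no preceding edges, so that its triangle is new. -/
def nestedStage (N : ℕ) : ℕ → NestedStage
  | 0 => { V := Fin 3, graph := ⊤, prev := ⊥ }
  | D + 1 => (nestedStage N D).next N

/-- The vertices of the graph with nested triangulations of depth `D` and branching `N`. -/
def NestedVertex (D N : ℕ) : Type := (nestedStage N D).V

/-- The graph `T_{D,N}` with nested triangulations, of depth `D` and branching `N`. -/
def nestedTriangulation (D N : ℕ) : SimpleGraph (NestedVertex D N) := (nestedStage N D).graph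

instance finite_nestedVertex (D N : ℕ) : Finite (NestedVertex D N) := by
  induction D with
  | zero => exact inferInstanceAs (Finite (Fin 3))
  | succ D ih =>
    have h1 : Finite (nestedStage N D).V := ih
    have h2 : Finite (nestedStage N D).NewTriangle :=
      inferInstanceAs (Finite {s : Finset (nestedStage N D).V //
        (nestedStage N D).graph.IsNClique 3 s ∧ ¬ (nestedStage N D).prev.IsNClique 3 s})
    exact inferInstanceAs (Finite ((nestedStage N D).V ⊕ ((nestedStage N D).NewTriangle × Fin N)))

noncomputable instance fintypeNestedVertex (D N : ℕ) : Fintype (NestedVertex D N) :=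
  Fintype.ofFinite _

noncomputable instance decidableEqNestedVertex (D N : ℕ) : DecidableEq (NestedVertex D N) :=
  Classical.decEq _

/-!
The spectral gap is treated through Poincaré inequalities. For a symmetric positive semidefinite
matrix that annihilates the constants, the second smallest eigenvalue `s` is attained by an
eigenvector orthogonal to the constants, and `s` times the squared norm is at most the quadratic
form on their orthogonal complement. An eigenfunction of the random walk lifts to the interchange
process along the position of one particle, so the gap of the interchange process is at most that of
the random walk. The converse holds once every Poincaré inequality for the random walk transfers to
the interchange process (`GapTransfers`).

Transfer is proved by eliminating vertices. Removing a vertex `x` by the star–mesh transformation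
replaces `α i j` by `α i j + α x i * α x j / ∑ y, α x y`. Harmonic extension to `x` shows that the
random walk gap does not decrease (`WalkGap.reducedRates`). Let `f` be an eigenfunction of the
interchange process at its gap. If some one-particle marginal of `f` is nonzero, it is an
eigenfunction of the random walk. Otherwise `f` sums to zero over every right coset of the
stabiliser of `x`, and the Poincaré inequality of the reduced process applies on each coset. The
comparison of the energies is the octopus inequality (`octopus_inequality`), which is needed only
when `x` has at most three neighbours.

In that case it has a short proof. Let `c y = α x y` for `y ≠ x`, and choose `c x` so that
`∑ c i = 0`. The claim is that `M = ∑ c i c j (i j)`, summed over all ordered pairs, is a positive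
semidefinite operator. As quadratic forms, expanding the square gives
`2 (∑ c i ^ 2) M = M ^ 2 - (1 / 3) ∑ c i c j c k c l A i j k l`,
with the last sum over ordered quadruples of distinct points, where `A i j k l` is the sum of the
four-group of `{i, j, k, l}` minus one three-cycle for each triple. It has nonnegative quadratic
form, as averaging over the alternating group is dominated by averaging over its normal four-group.
At most four weights are nonzero and only the one at `x` is negative, so every product
`c i c j c k c l` that occurs is nonpositive.

Elimination of vertices with at most three neighbours disposes of all graphs on at most four
vertices, of trees (by removing leaves, which changes no rate between distinct vertices), and of the
nested triangulations: each vertex of the last generation is joined to the three vertices of a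
triangle, so that the reduced rates live on the graph of the preceding stage. Trees embed into
nested triangulations because every vertex lies on a triangle that is new at the current stage
(`exists_newTriangle_mem`), so that a leaf can be placed on a vertex added at the next one.
-/

open Finset

/-! ### The second smallest eigenvalue -/

section Spectrum

open Matrix

/-- A real symmetric matrix has an orthonormal basis of eigenvectors, listed so that the eigenvalues
increase and are, in this order, the sorted roots of the characteristic polynomial. -/
lemma Matrix.IsHermitian.exists_sorted_eigenbasis {n : Type*} [Fintype n] [DecidableEq n]
    {A : Matrix n n ℝ} (hA : A.IsHermitian) :
    ∃ (b : Fin (Fintype.card n) → n → ℝ) (l : Fin (Fintype.card n) → ℝ),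
      Monotone l ∧ (∀ k, A *ᵥ b k = l k • b k) ∧
      (∀ k m, b k ⬝ᵥ b m = if k = m then 1 else 0) ∧
      (∀ f g : n → ℝ, f ⬝ᵥ g = ∑ k, (b k ⬝ᵥ f) * (b k ⬝ᵥ g)) ∧
      A.charpoly.roots.sort (· ≤ ·) = List.ofFn l := by
  let e : Fin (Fintype.card n) ≃ n :=
    Fin.revPerm.trans (Fintype.equivOfCardEq (Fintype.card_fin _))
  have hl : ∀ k, hA.eigenvalues (e k) = hA.eigenvalues₀ (Fin.rev k) := by
    intro k
    simp [Matrix.IsHermitian.eigenvalues, e]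
  refine ⟨fun k => (hA.eigenvectorBasis (e k)).ofLp, fun k => hA.eigenvalues (e k), ?_, ?_, ?_, ?_,
    ?_⟩
  · intro k m hkm
    simp only [hl]
    exact hA.eigenvalues₀_antitone (Fin.rev_le_rev.mpr hkm)
  · intro k
    exact hA.mulVec_eigenvectorBasis (e k)
  · intro k m
    have := (orthonormal_iff_ite.mp hA.eigenvectorBasis.orthonormal) (e m) (e k)
    rw [EuclideanSpace.inner_eq_star_dotProduct] at this
    simpa [eq_comm] using this
  · intro f g
    have := hA.eigenvectorBasis.sum_inner_mul_inner (WithLp.toLp 2 f) (WithLp.toLp 2 g)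
    simp only [EuclideanSpace.inner_eq_star_dotProduct, star_trivial] at this
    rw [dotProduct_comm, ← this, ← e.sum_comp]
    exact Finset.sum_congr rfl fun k _ => by rw [dotProduct_comm g]
  · refine List.Perm.eq_of_pairwise' (r := (· ≤ ·)) (Multiset.pairwise_sort _ _) ?_ ?_
    · refine (List.sortedLE_ofFn_iff.mpr ?_).pairwise
      intro k m hkm
      simp only [hl]
      exact hA.eigenvalues₀_antitone (Fin.rev_le_rev.mpr hkm)
    · rw [← Multiset.coe_eq_coe, Multiset.sort_eq, hA.roots_charpoly_eq_eigenvalues,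
        ← Fin.univ_val_map,
        ← Multiset.map_univ_val_equiv e, Multiset.map_map]
      rfl

/-- The second smallest eigenvalue of a positive semidefinite matrix that annihilates the constants
is attained by an eigenvector orthogonal to the constants. -/
lemma exists_eigenvector_secondSmallestEigenvalue {n : Type*} [Fintype n] [DecidableEq n]
    {A : Matrix n n ℝ} (hA : A.IsHermitian) (hpos : ∀ f : n → ℝ, 0 ≤ f ⬝ᵥ (A *ᵥ f))
    (h1 : A *ᵥ 1 = 0) (hn : 2 ≤ Fintype.card n) :
    ∃ f : n → ℝ, f ≠ 0 ∧ ∑ i, f i = 0 ∧ A *ᵥ f = secondSmallestEigenvalue A • f := by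
  obtain ⟨b, l, hmono, heig, horth, -, hsort⟩ := hA.exists_sorted_eigenbasis
  have hs : secondSmallestEigenvalue A = l ⟨1, hn⟩ := by
    rw [secondSmallestEigenvalue, hsort, List.getD_eq_getElem _ _ (by simp; omega)]
    simp
  have hnn : ∀ k, 0 ≤ l k := by
    intro k
    have := hpos (b k)
    rw [heig, dotProduct_smul, horth] at this
    simpa using this
  have hne : ∀ k, b k ≠ 0 := by
    intro k hk
    have := horth k k
    simp [hk] at this
  have hsum : ∀ f : n → ℝ, f ⬝ᵥ 1 = ∑ i, f i := by
    intro f; simp [dotProduct]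
  have hker : ∀ k, l k * (b k ⬝ᵥ 1) = 0 := by
    intro k
    have h2 : (A *ᵥ b k) ⬝ᵥ 1 = b k ⬝ᵥ (A *ᵥ 1) := by
      rw [dotProduct_mulVec, ← mulVec_transpose]
      congr 2
      simpa [Matrix.IsHermitian, conjTranspose_eq_transpose_of_trivial] using hA.symm
    rw [h1, heig, smul_dotProduct] at h2
    simpa using h2
  rw [hs]
  rcases (hnn ⟨1, hn⟩).lt_or_eq with hpos1 | hzero
  · exact ⟨b ⟨1, hn⟩, hne _, by
      rw [← hsum]; exact (mul_eq_zero.mp (hker _)).resolve_left hpos1.ne', heig _⟩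
  · have h0 : l ⟨0, by omega⟩ = 0 :=
      le_antisymm (hzero ▸ hmono (by simp [Fin.le_def])) (hnn _)
    by_cases hb : b ⟨0, by omega⟩ ⬝ᵥ 1 = 0
    · exact ⟨b ⟨0, by omega⟩, hne _, by rw [← hsum, hb], by rw [heig, h0, ← hzero]⟩
    -- Both of the first two eigenvectors lie in the kernel, so they can be combined.
    · refine ⟨(b ⟨1, hn⟩ ⬝ᵥ 1) • b ⟨0, by omega⟩ - (b ⟨0, by omega⟩ ⬝ᵥ 1) • b ⟨1, hn⟩, ?_, ?_, ?_⟩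
      · intro h
        have := congrArg (b ⟨1, hn⟩ ⬝ᵥ ·) h
        simp only [dotProduct_sub, dotProduct_smul, horth] at this
        simp at this
        exact hb (by simpa using this)
      · rw [← hsum, sub_dotProduct, smul_dotProduct, smul_dotProduct, smul_eq_mul, smul_eq_mul]
        ring
      · rw [mulVec_sub, mulVec_smul, mulVec_smul, heig, heig, h0, ← hzero]
        simp

/-- Variational bound for the second smallest eigenvalue on the complement of the constants. -/
lemma secondSmallestEigenvalue_mul_le {n : Type*} [Fintype n] [DecidableEq n]
    {A : Matrix n n ℝ} (hA : A.IsHermitian) (hpos : ∀ f : n → ℝ, 0 ≤ f ⬝ᵥ (A *ᵥ f))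
    (h1 : A *ᵥ 1 = 0) (hn : 2 ≤ Fintype.card n) (f : n → ℝ) (hf : ∑ i, f i = 0) :
    secondSmallestEigenvalue A * (f ⬝ᵥ f) ≤ f ⬝ᵥ (A *ᵥ f) := by
  obtain ⟨b, l, hmono, heig, horth, hpars, hsort⟩ := hA.exists_sorted_eigenbasis
  have hs : secondSmallestEigenvalue A = l ⟨1, hn⟩ := by
    rw [secondSmallestEigenvalue, hsort, List.getD_eq_getElem _ _ (by simp; omega)]
    simp
  have hself : ∀ k (g : n → ℝ), b k ⬝ᵥ (A *ᵥ g) = l k * (b k ⬝ᵥ g) := by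
    intro k g
    have h2 : (A *ᵥ b k) ⬝ᵥ g = b k ⬝ᵥ (A *ᵥ g) := by
      rw [dotProduct_mulVec, ← mulVec_transpose]
      congr 2
      simpa [Matrix.IsHermitian, conjTranspose_eq_transpose_of_trivial] using hA.symm
    rw [← h2, heig, smul_dotProduct, smul_eq_mul]
  have hsum : ∀ f : n → ℝ, f ⬝ᵥ 1 = ∑ i, f i := by
    intro f; simp [dotProduct]
  rw [hs]
  rcases le_or_gt (l ⟨1, hn⟩) 0 with hle | hlt
  · have hff : 0 ≤ f ⬝ᵥ f := Finset.sum_nonneg fun i _ => mul_self_nonneg (f i)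
    exact (mul_nonpos_of_nonpos_of_nonneg hle hff).trans (hpos f)
  -- All eigenvectors but the first are orthogonal to the constants, so the first one is constant.
  have hone : ∀ k : Fin (Fintype.card n), k.1 ≠ 0 → b k ⬝ᵥ 1 = 0 := by
    intro k hk
    have h2 := hself k 1
    rw [h1, dotProduct_zero] at h2
    have h3 : l ⟨1, hn⟩ ≤ l k := hmono (by simp [Fin.le_def]; omega)
    exact (mul_eq_zero.mp h2.symm).resolve_left (by linarith)
  have hexp : ∀ g : n → ℝ, g ⬝ᵥ 1 = (b ⟨0, by omega⟩ ⬝ᵥ g) * (b ⟨0, by omega⟩ ⬝ᵥ 1) := by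
    intro g
    rw [hpars g 1, Finset.sum_eq_single_of_mem ⟨0, by omega⟩ (Finset.mem_univ _)]
    intro k _ hk
    rw [hone k (fun h => hk (Fin.ext h)), mul_zero]
  have hb0 : b ⟨0, by omega⟩ ⬝ᵥ f = 0 := by
    have h2 := hexp f
    rw [hsum, hf] at h2
    refine (mul_eq_zero.mp h2.symm).resolve_right fun h3 => ?_
    have h4 := hexp 1
    rw [h3, mul_zero, hsum] at h4
    simp at h4
    omega
  rw [hpars f f, hpars f (A *ᵥ f), Finset.mul_sum]
  refine Finset.sum_le_sum fun k _ => ?_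
  rw [hself]
  by_cases hk : k.1 = 0
  · have : k = ⟨0, by omega⟩ := Fin.ext hk
    rw [this, hb0]; simp
  · have h3 : l ⟨1, hn⟩ ≤ l k := hmono (by simp [Fin.le_def]; omega)
    nlinarith [mul_self_nonneg (b k ⬝ᵥ f)]

end Spectrum

/-! ### Autocorrelations of functions on permutations -/

/-- The autocorrelation at `g` of a function `f` on permutations: the inner product of `f` with its
left translate by `g`. -/
def autocorrelation {V : Type*} [Fintype V] [DecidableEq V] (f : Equiv.Perm V → ℝ)
    (g : Equiv.Perm V) : ℝ :=
  ∑ σ, f σ * f (g * σ)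

section Autocorrelation

variable {V : Type*} [Fintype V] [DecidableEq V] (f : Equiv.Perm V → ℝ)

lemma sum_translate_mul_translate (g h : Equiv.Perm V) :
    ∑ σ, f (g * σ) * f (h * σ) = autocorrelation f (h * g⁻¹) := by
  rw [autocorrelation, ← Equiv.sum_comp (Equiv.mulLeft g) fun σ => f σ * f (h * g⁻¹ * σ)]
  simp [mul_assoc]

lemma autocorrelation_inv (g : Equiv.Perm V) :
    autocorrelation f g⁻¹ = autocorrelation f g := by
  have h := sum_translate_mul_translate f g 1
  rw [one_mul] at h
  rw [← h, autocorrelation]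
  simp [mul_comm]

lemma sum_sq_sub_translate (g : Equiv.Perm V) :
    ∑ σ, (f σ - f (g * σ)) ^ 2 = 2 * (autocorrelation f 1 - autocorrelation f g) := by
  have h := sum_translate_mul_translate f g g
  rw [mul_inv_cancel] at h
  simp only [sub_sq, sum_add_distrib, sum_sub_distrib, autocorrelation, one_mul] at h ⊢
  simp only [pow_two, h, mul_assoc, ← mul_sum]
  ring

/-- If `a`, `b` generate a Klein four-group normalised by `r`, then averaging over that group and
translating by `r` cannot increase correlation. This is the Cauchy–Schwarz inequality for the
four-group average of `f` and its translate by `r`. -/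
lemma autocorrelation_klein_coset_le {a b r : Equiv.Perm V} (haa : a * a = 1) (hbb : b * b = 1)
    (hab : b * a = a * b) (har : a * r = r * (a * b)) (hbr : b * r = r * a) :
    autocorrelation f r + autocorrelation f (r * a) + autocorrelation f (r * b) +
        autocorrelation f (r * (a * b)) ≤
      autocorrelation f 1 + autocorrelation f a + autocorrelation f b +
        autocorrelation f (a * b) := by
  set F : Equiv.Perm V → ℝ := fun σ => f (1 * σ) + f (a * σ) + f (b * σ) + f (a * b * σ) with hF
  have hai : a⁻¹ = a := inv_eq_of_mul_eq_one_left haa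
  have hbi : b⁻¹ = b := inv_eq_of_mul_eq_one_left hbb
  have haa' : ∀ x, a * (a * x) = x := fun x => by rw [← mul_assoc, haa, one_mul]
  have hab' : ∀ x, b * (a * x) = a * (b * x) := fun x => by rw [← mul_assoc, hab, mul_assoc]
  have har' : ∀ x, a * (r * x) = r * (a * (b * x)) := fun x => by
    rw [← mul_assoc, har]; simp only [mul_assoc]
  have hsq : ∑ σ, F (r * σ) ^ 2 = ∑ σ, F σ ^ 2 := Equiv.sum_comp (Equiv.mulLeft r) fun σ => F σ ^ 2
  have hFF : ∑ σ, F σ ^ 2 = 4 * (autocorrelation f 1 + autocorrelation f a +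
      autocorrelation f b + autocorrelation f (a * b)) := by
    simp only [hF, pow_two, add_mul, mul_add, sum_add_distrib, sum_translate_mul_translate]
    simp only [mul_inv_rev, inv_one, hai, hbi, mul_assoc, mul_one, one_mul, haa, hbb, hab,
      haa', hab']
    ring
  have hFr : ∑ σ, F σ * F (r * σ) = 4 * (autocorrelation f r + autocorrelation f (r * a) +
      autocorrelation f (r * b) + autocorrelation f (r * (a * b))) := by
    simp only [hF, ← mul_assoc _ r, add_mul, mul_add, sum_add_distrib,
      sum_translate_mul_translate]
    simp only [mul_inv_rev, inv_one, hai, hbi, mul_assoc, mul_one, one_mul, haa, hbb, hab,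
      haa', hab', har, har', hbr]
    ring
  have h0 : 0 ≤ ∑ σ, (F σ - F (r * σ)) ^ 2 := sum_nonneg fun σ _ => sq_nonneg _
  simp only [sub_sq, sum_add_distrib, sum_sub_distrib, hsq, mul_assoc, ← mul_sum, hFr, hFF] at h0
  linarith

/-- The projection onto functions invariant under the four-group of `{i, j, k, l}` dominates the
projection onto functions invariant under its alternating group, written out for the
autocorrelation: one three-cycle for each triple suffices, since inverses correlate equally. -/
lemma autocorrelation_three_cycles_le {i j k l : V} (hij : i ≠ j) (hik : i ≠ k) (hil : i ≠ l)
    (hjk : j ≠ k) (hjl : j ≠ l) (hkl : k ≠ l) :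
    autocorrelation f (Equiv.swap i j * Equiv.swap j k) +
        autocorrelation f (Equiv.swap i j * Equiv.swap j l) +
        autocorrelation f (Equiv.swap i k * Equiv.swap k l) +
        autocorrelation f (Equiv.swap j k * Equiv.swap k l) ≤
      autocorrelation f 1 + autocorrelation f (Equiv.swap i j * Equiv.swap k l) +
        autocorrelation f (Equiv.swap i k * Equiv.swap j l) +
        autocorrelation f (Equiv.swap i l * Equiv.swap j k) := by
  have key := autocorrelation_klein_coset_le f (a := Equiv.swap i j * Equiv.swap k l)
    (b := Equiv.swap i k * Equiv.swap j l) (r := Equiv.swap j k * Equiv.swap k l)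
    (by ext y; simp only [Equiv.Perm.mul_apply, Equiv.swap_apply_def, Equiv.Perm.one_apply]; grind)
    (by ext y; simp only [Equiv.Perm.mul_apply, Equiv.swap_apply_def, Equiv.Perm.one_apply]; grind)
    (by ext y; simp only [Equiv.Perm.mul_apply, Equiv.swap_apply_def]; grind)
    (by ext y; simp only [Equiv.Perm.mul_apply, Equiv.swap_apply_def]; grind)
    (by ext y; simp only [Equiv.Perm.mul_apply, Equiv.swap_apply_def]; grind)
  have h3 : Equiv.swap i j * Equiv.swap k l * (Equiv.swap i k * Equiv.swap j l) =
      Equiv.swap i l * Equiv.swap j k := by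
    ext y; simp only [Equiv.Perm.mul_apply, Equiv.swap_apply_def]; grind
  have h4 : Equiv.swap j k * Equiv.swap k l * (Equiv.swap i j * Equiv.swap k l) =
      (Equiv.swap i j * Equiv.swap j k)⁻¹ := by
    rw [mul_inv_rev, Equiv.swap_inv, Equiv.swap_inv]
    ext y; simp only [Equiv.Perm.mul_apply, Equiv.swap_apply_def]; grind
  have h5 : Equiv.swap j k * Equiv.swap k l * (Equiv.swap i k * Equiv.swap j l) =
      (Equiv.swap i k * Equiv.swap k l)⁻¹ := by
    rw [mul_inv_rev, Equiv.swap_inv, Equiv.swap_inv]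
    ext y; simp only [Equiv.Perm.mul_apply, Equiv.swap_apply_def]; grind
  have h6 : Equiv.swap j k * Equiv.swap k l * (Equiv.swap i l * Equiv.swap j k) =
      (Equiv.swap i j * Equiv.swap j l) := by
    ext y; simp only [Equiv.Perm.mul_apply, Equiv.swap_apply_def]; grind
  rw [h3, h4, h5, h6, autocorrelation_inv, autocorrelation_inv] at key
  linarith

end Autocorrelation

/-! ### The octopus inequality with at most three legs -/

section Octopus

variable {V : Type*} [DecidableEq V]

/-- The indicator of `i ≠ j`, as a real number. -/
def neIndicator (i j : V) : ℝ := if i = j then 0 else 1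

/-- The indicator of `i`, `j`, `k` being distinct. -/
def distinctIndicator (i j k : V) : ℝ := neIndicator i j * neIndicator i k * neIndicator j k

/-- The indicator of `i`, `j`, `k`, `l` being distinct, multiplied by the product of the values of
`c` at these points. -/
def distinctWeight (c : V → ℝ) (i j k l : V) : ℝ :=
  distinctIndicator i j k * (neIndicator i l * neIndicator j l * neIndicator k l) *
    (c i * c j * c k * c l)

lemma distinctIndicator_eq_zero {i j k : V} (h : ¬(i ≠ j ∧ i ≠ k ∧ j ≠ k)) :
    distinctIndicator i j k = 0 := by
  unfold distinctIndicator neIndicator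
  grind

lemma neIndicator_comm (i j : V) : neIndicator i j = neIndicator j i := by
  simp [neIndicator, eq_comm]

variable [Fintype V]

lemma sum_mul_neIndicator (i : V) (F : V → ℝ) : ∑ j, neIndicator i j * F j = ∑ j, F j - F i := by
  have : ∀ j, neIndicator i j * F j = F j - if i = j then F j else 0 := by
    intro j; unfold neIndicator; split_ifs <;> simp
  simp [this]

/-- A double sum over all pairs, sorted by the coincidences of the pair with a given pair. -/
lemma sum_pairs_eq {i j : V} (hij : i ≠ j) (G : V → V → ℝ) :
    ∑ k, ∑ l, G k l = ∑ k, G k k + G i j + G j i +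
      ∑ k, neIndicator i k * neIndicator j k * (G i k + G k i + G j k + G k j) +
      ∑ k, ∑ l, neIndicator i k * neIndicator j k *
        (neIndicator i l * neIndicator j l * neIndicator k l) * G k l := by
  have hpt : ∀ k l, G k l = (if k = l then G k l else 0) +
      (if k = i then if l = j then G k l else 0 else 0) +
      (if k = j then if l = i then G k l else 0 else 0) +
      ((if k = i then neIndicator i l * neIndicator j l * G i l else 0) +
       (if l = i then neIndicator i k * neIndicator j k * G k i else 0) +
       (if k = j then neIndicator i l * neIndicator j l * G j l else 0) +
       (if l = j then neIndicator i k * neIndicator j k * G k j else 0)) +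
      neIndicator i k * neIndicator j k *
        (neIndicator i l * neIndicator j l * neIndicator k l) * G k l := by
    intro k l
    unfold neIndicator
    grind
  rw [sum_congr rfl fun k _ => sum_congr rfl fun l _ => hpt k l]
  simp only [sum_add_distrib, mul_add]
  have h1 : ∀ (a : V) (F : V → ℝ), ∑ k, ∑ l, (if k = a then F l else 0) = ∑ l, F l := by
    intro a F
    rw [sum_comm]
    simp
  simp only [h1]
  simp

lemma sum_distinctWeight_swap₁₂ (c : V → ℝ) (F : V → V → V → V → ℝ) :
    ∑ i, ∑ j, ∑ k, ∑ l, distinctWeight c i j k l * F j i k l =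
      ∑ i, ∑ j, ∑ k, ∑ l, distinctWeight c i j k l * F i j k l := by
  rw [sum_comm]
  refine sum_congr rfl fun i _ => sum_congr rfl fun j _ => sum_congr rfl fun k _ =>
    sum_congr rfl fun l _ => ?_
  simp only [distinctWeight, distinctIndicator, neIndicator_comm j i]
  ring

lemma sum_distinctWeight_swap₂₃ (c : V → ℝ) (F : V → V → V → V → ℝ) :
    ∑ i, ∑ j, ∑ k, ∑ l, distinctWeight c i j k l * F i k j l =
      ∑ i, ∑ j, ∑ k, ∑ l, distinctWeight c i j k l * F i j k l := by
  refine sum_congr rfl fun i _ => ?_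
  rw [sum_comm]
  refine sum_congr rfl fun j _ => sum_congr rfl fun k _ => sum_congr rfl fun l _ => ?_
  simp only [distinctWeight, distinctIndicator, neIndicator_comm k j]
  ring

lemma sum_distinctWeight_swap₃₄ (c : V → ℝ) (F : V → V → V → V → ℝ) :
    ∑ i, ∑ j, ∑ k, ∑ l, distinctWeight c i j k l * F i j l k =
      ∑ i, ∑ j, ∑ k, ∑ l, distinctWeight c i j k l * F i j k l := by
  refine sum_congr rfl fun i _ => sum_congr rfl fun j _ => ?_
  rw [sum_comm]
  refine sum_congr rfl fun k _ => sum_congr rfl fun l _ => ?_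
  simp only [distinctWeight, distinctIndicator, neIndicator_comm l k]
  ring

/-- For weights of total zero, summing out the last of four distinct points leaves a sum over
triples: the last weight contributes minus the sum of the other three, and these contribute equally
when the summand is cyclically symmetric. -/
lemma sum_distinctWeight_of_cyclic {c : V → ℝ} (hc : ∑ i, c i = 0) {F : V → V → V → ℝ}
    (hF : ∀ i j k, i ≠ j → i ≠ k → j ≠ k → F i j k = F j k i) :
    ∑ i, ∑ j, ∑ k, ∑ l, distinctWeight c i j k l * F i j k =
      -3 * ∑ i, ∑ j, ∑ k, distinctIndicator i j k * (c i * c j ^ 2 * c k * F i j k) := by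
  have hl : ∀ i j k, ∑ l, distinctWeight c i j k l * F i j k =
      -(distinctIndicator i j k * (c i ^ 2 * c j * c k * F i j k)) -
      (distinctIndicator i j k * (c i * c j ^ 2 * c k * F i j k)) -
      (distinctIndicator i j k * (c i * c j * c k ^ 2 * F i j k)) := by
    intro i j k
    have h4 : distinctIndicator i j k *
        ∑ l, neIndicator i l * neIndicator j l * neIndicator k l * c l =
        distinctIndicator i j k * (-(c i) - c j - c k) := by
      by_cases h : i ≠ j ∧ i ≠ k ∧ j ≠ k
      · congr 1
        simp only [mul_assoc]
        rw [sum_mul_neIndicator, sum_mul_neIndicator, sum_mul_neIndicator, hc]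
        simp [neIndicator, h.2.1.symm, h.1.symm, h.2.2.symm]
        ring
      · simp [distinctIndicator_eq_zero h]
    calc _ = distinctIndicator i j k *
        (∑ l, neIndicator i l * neIndicator j l * neIndicator k l * c l) *
          (c i * c j * c k * F i j k) := by
          rw [mul_sum, sum_mul]
          exact sum_congr rfl fun l _ => by unfold distinctWeight; ring
      _ = _ := by rw [h4]; ring
  have hrot : ∀ H : V → V → V → ℝ, ∑ i, ∑ j, ∑ k, H j k i = ∑ i, ∑ j, ∑ k, H i j k := by
    intro H
    rw [sum_comm]
    exact sum_congr rfl fun i _ => sum_comm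
  have h1 : ∑ i, ∑ j, ∑ k, distinctIndicator i j k * (c i ^ 2 * c j * c k * F i j k) =
      ∑ i, ∑ j, ∑ k, distinctIndicator i j k * (c i * c j ^ 2 * c k * F i j k) := by
    rw [← hrot]
    refine sum_congr rfl fun i _ => sum_congr rfl fun j _ => sum_congr rfl fun k _ => ?_
    by_cases h : i ≠ j ∧ i ≠ k ∧ j ≠ k
    · rw [hF i j k h.1 h.2.1 h.2.2]
      simp only [distinctIndicator, neIndicator_comm k i, neIndicator_comm j i]
      ring
    · rw [distinctIndicator_eq_zero h, distinctIndicator_eq_zero (i := j) (by tauto)]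
      simp
  have h2 : ∑ i, ∑ j, ∑ k, distinctIndicator i j k * (c i * c j * c k ^ 2 * F i j k) =
      ∑ i, ∑ j, ∑ k, distinctIndicator i j k * (c i * c j ^ 2 * c k * F i j k) := by
    symm
    rw [← hrot]
    refine sum_congr rfl fun i _ => sum_congr rfl fun j _ => sum_congr rfl fun k _ => ?_
    by_cases h : i ≠ j ∧ i ≠ k ∧ j ≠ k
    · rw [hF i j k h.1 h.2.1 h.2.2]
      simp only [distinctIndicator, neIndicator_comm k i, neIndicator_comm j i]
      ring
    · rw [distinctIndicator_eq_zero h, distinctIndicator_eq_zero (i := j) (by tauto)]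
      simp
  simp only [hl, sum_sub_distrib, sum_neg_distrib, h1, h2]
  ring


lemma sum_distinctIndicator {c : V → ℝ} (hc : ∑ i, c i = 0) (a : ℝ) :
    ∑ i, ∑ j, ∑ k, distinctIndicator i j k * (c i * c j ^ 2 * c k * a) =
      (∑ i, c i ^ 2) ^ 2 * a -
        2 * (∑ i, ∑ j, neIndicator i j * (c i ^ 2 * c j ^ 2)) * a := by
  have h1 : ∀ i j, ∑ k, distinctIndicator i j k * (c i * c j ^ 2 * c k * a) =
      -(neIndicator i j * (c i ^ 2 * c j ^ 2)) * a - neIndicator j i * c i * (c j ^ 3 * a) := by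
    intro i j
    have h2 : neIndicator i j * ∑ k, neIndicator i k * (neIndicator j k * c k) =
        neIndicator i j * (-(c i) - c j) := by
      by_cases h : i = j
      · simp [neIndicator, h]
      · rw [sum_mul_neIndicator, sum_mul_neIndicator, hc]
        simp [neIndicator, h, Ne.symm h]
        ring
    calc _ = neIndicator i j * (∑ k, neIndicator i k * (neIndicator j k * c k)) *
          (c i * c j ^ 2 * a) := by
          rw [mul_sum, sum_mul]
          exact sum_congr rfl fun k _ => by unfold distinctIndicator; ring
      _ = _ := by rw [h2, neIndicator_comm j i]; ring
  have h3 : ∑ i, ∑ j, neIndicator j i * c i * (c j ^ 3 * a) = -∑ j, c j ^ 4 * a := by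
    rw [sum_comm, ← sum_neg_distrib]
    refine sum_congr rfl fun j _ => ?_
    rw [← sum_mul, sum_mul_neIndicator, hc]
    ring
  have h4 : ∑ i, ∑ j, neIndicator i j * (c i ^ 2 * c j ^ 2) =
      (∑ i, c i ^ 2) ^ 2 - ∑ i, c i ^ 4 := by
    simp only [sum_mul_neIndicator, sum_sub_distrib, pow_two (∑ i, _), sum_mul_sum]
    congr 1
    exact sum_congr rfl fun i _ => by ring
  simp only [h1, sum_sub_distrib, h3, ← sum_mul, sum_neg_distrib, h4]
  ring

/-- The square of the operator `∑ c i c j (i j)`, evaluated on `f` and expanded by the coincidences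
among four indices. -/
lemma sum_sum_sum_sum_autocorrelation_swap (c : V → ℝ) (f : Equiv.Perm V → ℝ) :
    ∑ i, ∑ j, ∑ k, ∑ l, c i * c j * c k * c l *
        autocorrelation f (Equiv.swap i j * Equiv.swap k l) =
      2 * (∑ i, c i ^ 2) * ∑ i, ∑ j, c i * c j * autocorrelation f (Equiv.swap i j) -
      (∑ i, c i ^ 2) ^ 2 * autocorrelation f 1 +
      2 * (∑ i, ∑ j, neIndicator i j * (c i ^ 2 * c j ^ 2)) * autocorrelation f 1 +
      4 * ∑ i, ∑ j, ∑ k, distinctIndicator i j k *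
        (c i * c j ^ 2 * c k * autocorrelation f (Equiv.swap i j * Equiv.swap j k)) +
      ∑ i, ∑ j, ∑ k, ∑ l, distinctWeight c i j k l *
        autocorrelation f (Equiv.swap i j * Equiv.swap k l) := by
  set p := ∑ i, c i ^ 2 with hp
  set S := ∑ i, ∑ j, c i * c j * autocorrelation f (Equiv.swap i j) with hS
  have hself : ∀ i : V, Equiv.swap i i = (1 : Equiv.Perm V) := fun i => Equiv.swap_self i
  have hpair : ∀ i j, ∑ k, ∑ l, c i * c j * c k * c l *
        autocorrelation f (Equiv.swap i j * Equiv.swap k l) =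
      (if i = j then c i ^ 2 * S else 0) +
      neIndicator i j * (c i * c j * autocorrelation f (Equiv.swap i j)) * p +
      2 * (neIndicator i j * (c i ^ 2 * c j ^ 2)) * autocorrelation f 1 +
      2 * ∑ k, distinctIndicator i j k *
        (c i ^ 2 * c j * c k * autocorrelation f (Equiv.swap i j * Equiv.swap i k)) +
      2 * ∑ k, distinctIndicator i j k *
        (c i * c j ^ 2 * c k * autocorrelation f (Equiv.swap i j * Equiv.swap j k)) +
      ∑ k, ∑ l, distinctWeight c i j k l *
        autocorrelation f (Equiv.swap i j * Equiv.swap k l) := by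
    intro i j
    by_cases hij : i = j
    · subst hij
      simp only [distinctWeight, distinctIndicator, neIndicator, hS, mul_sum]
      simp only [hself, one_mul, if_true, zero_mul, mul_zero, sum_const_zero, add_zero]
      exact sum_congr rfl fun k _ => sum_congr rfl fun l _ => by ring
    · rw [sum_pairs_eq hij]
      have hone : neIndicator i j = 1 := by simp [neIndicator, hij]
      simp only [distinctWeight, distinctIndicator, hone, hself, mul_one, one_mul, if_neg hij,
        Equiv.swap_comm j i, Equiv.swap_mul_self, hp, mul_sum, zero_add]
      congr 1
      · rw [add_assoc _ (∑ _, _) (∑ _, _), ← sum_add_distrib]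
        congr 1
        · rw [add_assoc]
          congr 1
          · exact sum_congr rfl fun k _ => by ring
          · ring
        · exact sum_congr rfl fun k _ => by
            rw [Equiv.swap_comm k i, Equiv.swap_comm k j]
            ring
      · exact sum_congr rfl fun k _ => sum_congr rfl fun l _ => by ring
  have hT : ∑ i, ∑ j, ∑ k, distinctIndicator i j k *
        (c i ^ 2 * c j * c k * autocorrelation f (Equiv.swap i j * Equiv.swap i k)) =
      ∑ i, ∑ j, ∑ k, distinctIndicator i j k *
        (c i * c j ^ 2 * c k * autocorrelation f (Equiv.swap i j * Equiv.swap j k)) := by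
    rw [sum_comm]
    refine sum_congr rfl fun i _ => sum_congr rfl fun j _ => sum_congr rfl fun k _ => ?_
    rw [Equiv.swap_comm j i]
    simp only [distinctIndicator, neIndicator_comm j i]
    ring
  have hS' : ∑ i, ∑ j, neIndicator i j * (c i * c j * autocorrelation f (Equiv.swap i j)) =
      S - p * autocorrelation f 1 := by
    simp only [sum_mul_neIndicator, sum_sub_distrib, hself, hS, hp, sum_mul]
    congr 1
    exact sum_congr rfl fun k _ => by ring
  simp only [hpair, sum_add_distrib, ← mul_sum, ← sum_mul, hT, hS', sum_ite_eq, mem_univ, if_true,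
    ← hp]
  ring

/-- The octopus inequality for weights of which at most three besides the one at `x` are nonzero.
Twice the form times `∑ c i ^ 2` is the squared norm of `∑ c i c j (i j) f`, plus a combination of
differences of averages over four-groups and alternating groups on four points; these differences
occur with positive multiples of `-c i c j c k c l`, which is nonnegative as four distinct points
carrying nonzero weights include `x`. -/
theorem octopus_inequality {c : V → ℝ} (hc : ∑ i, c i = 0) (x : V) (hpos : ∀ y, y ≠ x → 0 ≤ c y)
    (hcard : #{y | y ≠ x ∧ c y ≠ 0} ≤ 3) (f : Equiv.Perm V → ℝ) :
    0 ≤ ∑ i, ∑ j, c i * c j * autocorrelation f (Equiv.swap i j) := by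
  by_cases hzero : ∑ i, c i ^ 2 = 0
  · have : ∀ i, c i = 0 := by
      intro i
      have := (sum_eq_zero_iff_of_nonneg fun i _ => sq_nonneg (c i)).mp hzero i (mem_univ _)
      exact pow_eq_zero_iff (two_ne_zero) |>.mp this
    simp [this]
  have hp : 0 < ∑ i, c i ^ 2 := lt_of_le_of_ne (sum_nonneg fun i _ => sq_nonneg _) (Ne.symm hzero)
  have hx : c x ≤ 0 := by
    have : c x = -∑ y ∈ univ.erase x, c y := by
      rw [← add_sum_erase _ _ (mem_univ x)] at hc
      linarith
    rw [this, neg_nonpos]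
    exact sum_nonneg fun y hy => hpos y (ne_of_mem_erase hy)
  have hweight : ∀ i j k l, i ≠ j → i ≠ k → i ≠ l → j ≠ k → j ≠ l → k ≠ l →
      c i * c j * c k * c l ≤ 0 := by
    intro i j k l hij hik hil hjk hjl hkl
    by_cases hi : i = x
    · subst hi
      have h1 := mul_nonneg (mul_nonneg (hpos j hij.symm) (hpos k hik.symm)) (hpos l hil.symm)
      nlinarith
    by_cases hj : j = x
    · subst hj
      have h1 := mul_nonneg (mul_nonneg (hpos i hij) (hpos k hjk.symm)) (hpos l hjl.symm)
      nlinarith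
    by_cases hk : k = x
    · subst hk
      have h1 := mul_nonneg (mul_nonneg (hpos i hik) (hpos j hjk)) (hpos l hkl.symm)
      nlinarith
    by_cases hl : l = x
    · subst hl
      have h1 := mul_nonneg (mul_nonneg (hpos i hil) (hpos j hjl)) (hpos k hkl)
      nlinarith
    by_contra! h
    have hci : c i ≠ 0 := by rintro h0; simp [h0] at h
    have hcj : c j ≠ 0 := by rintro h0; simp [h0] at h
    have hck : c k ≠ 0 := by rintro h0; simp [h0] at h
    have hcl : c l ≠ 0 := by rintro h0; simp [h0] at h
    have hsub : ({i, j, k, l} : Finset V) ⊆ ({y | y ≠ x ∧ c y ≠ 0} : Finset V) := by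
      intro y
      simp only [mem_insert, mem_singleton, mem_filter, mem_univ, true_and]
      rintro (rfl | rfl | rfl | rfl) <;> exact ⟨by assumption, by assumption⟩
    have h4 : #({i, j, k, l} : Finset V) = 4 := by
      rw [card_insert_of_notMem, card_insert_of_notMem, card_pair hkl] <;> simp [*]
    have := card_le_card hsub
    omega
  have hU : ∑ i, ∑ j, ∑ k, ∑ l, distinctWeight c i j k l *
      (autocorrelation f 1 + autocorrelation f (Equiv.swap i j * Equiv.swap k l) +
        autocorrelation f (Equiv.swap i k * Equiv.swap j l) +
        autocorrelation f (Equiv.swap i l * Equiv.swap j k) -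
        (autocorrelation f (Equiv.swap i j * Equiv.swap j k) +
        autocorrelation f (Equiv.swap i j * Equiv.swap j l) +
        autocorrelation f (Equiv.swap i k * Equiv.swap k l) +
        autocorrelation f (Equiv.swap j k * Equiv.swap k l))) ≤ 0 := by
    refine sum_nonpos fun i _ => sum_nonpos fun j _ => sum_nonpos fun k _ =>
      sum_nonpos fun l _ => ?_
    by_cases h : i ≠ j ∧ i ≠ k ∧ i ≠ l ∧ j ≠ k ∧ j ≠ l ∧ k ≠ l
    · obtain ⟨hij, hik, hil, hjk, hjl, hkl⟩ := h
      have h1 := autocorrelation_three_cycles_le f hij hik hil hjk hjl hkl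
      refine mul_nonpos_of_nonpos_of_nonneg ?_ (by linarith)
      simp [distinctWeight, distinctIndicator, neIndicator, *]
    · have : distinctWeight c i j k l = 0 := by
        unfold distinctWeight distinctIndicator neIndicator
        grind
      simp [this]
  simp only [mul_add, mul_sub, sum_add_distrib, sum_sub_distrib] at hU
  -- By symmetry of the weights, the correlations in `hU` fall into three classes.
  have e1 := sum_distinctWeight_swap₂₃ c fun i j k l =>
    autocorrelation f (Equiv.swap i j * Equiv.swap k l)
  have e2 := sum_distinctWeight_swap₃₄ c fun i j k l =>
    autocorrelation f (Equiv.swap i k * Equiv.swap j l)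
  have e3 := sum_distinctWeight_swap₃₄ c fun i j k _ =>
    autocorrelation f (Equiv.swap i j * Equiv.swap j k)
  have e4 := sum_distinctWeight_swap₂₃ c fun i j _ l =>
    autocorrelation f (Equiv.swap i j * Equiv.swap j l)
  have e5 := sum_distinctWeight_swap₁₂ c fun i _ k l =>
    autocorrelation f (Equiv.swap i k * Equiv.swap k l)
  have e6 := sum_distinctWeight_of_cyclic hc
    (F := fun i j k => autocorrelation f (Equiv.swap i j * Equiv.swap j k)) (by
      intro i j k hij hik hjk
      congr 1
      clear * - hij hik hjk
      ext y; simp only [Equiv.Perm.mul_apply, Equiv.swap_apply_def]; grind)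
  have e7 := sum_distinctWeight_of_cyclic hc (F := fun _ _ _ => autocorrelation f 1)
    fun _ _ _ _ _ _ => rfl
  have e8 := sum_distinctIndicator hc (autocorrelation f 1)
  have hsq : 0 ≤ ∑ i, ∑ j, ∑ k, ∑ l, c i * c j * c k * c l *
        autocorrelation f (Equiv.swap i j * Equiv.swap k l) := by
    have h0 : ∑ σ, (∑ i, ∑ j, c i * c j * f (Equiv.swap i j * σ)) ^ 2 =
        ∑ i, ∑ j, ∑ k, ∑ l, c i * c j * c k * c l *
          autocorrelation f (Equiv.swap i j * Equiv.swap k l) := by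
      have h1 : ∀ i j k l, c i * c j * c k * c l *
          autocorrelation f (Equiv.swap i j * Equiv.swap k l) =
          ∑ σ, c i * c j * f (Equiv.swap i j * σ) * (c k * c l * f (Equiv.swap k l * σ)) := by
        intro i j k l
        have h2 := sum_translate_mul_translate f (Equiv.swap k l) (Equiv.swap i j)
        rw [Equiv.swap_inv] at h2
        rw [← h2, mul_sum]
        exact sum_congr rfl fun σ _ => by ring
      simp only [h1, pow_two, sum_mul]
      simp only [mul_sum]
      rw [sum_comm]
      refine sum_congr rfl fun i _ => ?_
      rw [sum_comm]
      refine sum_congr rfl fun j _ => ?_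
      rw [sum_comm]
      exact sum_congr rfl fun k _ => sum_comm
    rw [← h0]
    exact sum_nonneg fun σ _ => sq_nonneg _
  have hmain := sum_sum_sum_sum_autocorrelation_swap c f
  have hfinal : 0 ≤ 2 * (∑ i, c i ^ 2) *
      ∑ i, ∑ j, c i * c j * autocorrelation f (Equiv.swap i j) := by
    linarith
  exact nonneg_of_mul_nonneg_right hfinal (by linarith)

end Octopus

/-! ### Poincaré inequalities for the two processes -/

section Energies

open Matrix

variable {V : Type*} [Fintype V]

/-- Twice the quadratic form of the random walk Laplacian. -/
def walkEnergy (α : V → V → ℝ) (h : V → ℝ) : ℝ := ∑ i, ∑ j, α i j * (h i - h j) ^ 2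

lemma walkEnergy_nonneg {α : V → V → ℝ} (hα : ∀ i j, 0 ≤ α i j) (h : V → ℝ) : 0 ≤ walkEnergy α h :=
  sum_nonneg fun i _ => sum_nonneg fun j _ => mul_nonneg (hα i j) (sq_nonneg _)

/-- Poincaré inequality with constant `g` for the random walk. -/
def WalkGap (α : V → V → ℝ) (g : ℝ) : Prop :=
  ∀ h : V → ℝ, ∑ i, h i = 0 → 2 * g * ∑ i, h i ^ 2 ≤ walkEnergy α h

variable [DecidableEq V]

/-- Twice the quadratic form of the interchange Laplacian. -/
def interchangeEnergy (α : V → V → ℝ) (f : Equiv.Perm V → ℝ) : ℝ :=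
  ∑ i, ∑ j, α i j * (autocorrelation f 1 - autocorrelation f (Equiv.swap i j))

/-- Poincaré inequality with constant `g` for the interchange process. -/
def InterchangeGap (α : V → V → ℝ) (g : ℝ) : Prop :=
  ∀ f : Equiv.Perm V → ℝ, ∑ σ, f σ = 0 → 2 * g * ∑ σ, f σ ^ 2 ≤ interchangeEnergy α f

/-- Every Poincaré inequality for the random walk holds for the interchange process as well. -/
def GapTransfers (α : V → V → ℝ) : Prop :=
  ∀ g : ℝ, 0 ≤ g → WalkGap α g → InterchangeGap α g

lemma randomWalkLaplacian_mulVec (α : V → V → ℝ) (h : V → ℝ) (i : V) :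
    (randomWalkLaplacian α *ᵥ h) i = ∑ j, α i j * (h i - h j) := by
  have h1 : ∀ j, randomWalkLaplacian α i j * h j =
      (if i = j then (∑ k with k ≠ i, α i k + α i i) * h i else 0) - α i j * h j := by
    intro j
    simp only [randomWalkLaplacian, of_apply]
    split_ifs with hij
    · subst hij; ring
    · ring
  have h2 : ∑ k with k ≠ i, α i k + α i i = ∑ k, α i k := by
    rw [filter_ne', sum_erase_add _ _ (mem_univ i)]
  simp only [mulVec, dotProduct, h1, h2, sum_sub_distrib, sum_ite_eq, mem_univ, if_true, sum_mul,
    mul_sub]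

lemma interchangeLaplacian_mulVec (α : V → V → ℝ) (f : Equiv.Perm V → ℝ) (σ : Equiv.Perm V) :
    (interchangeLaplacian α *ᵥ f) σ =
      1 / 2 * ∑ i, ∑ j, α i j * (f σ - f (Equiv.swap i j * σ)) := by
  have h1 : ∀ τ, interchangeLaplacian α σ τ * f τ =
      (if σ = τ then 1 / 2 * (∑ i, ∑ j with j ≠ i, α i j) * f σ else 0) -
      1 / 2 * ∑ i, ∑ j with j ≠ i, if τ = Equiv.swap i j * σ then α i j * f τ else 0 := by
    intro τ
    simp only [interchangeLaplacian, of_apply]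
    split_ifs with hστ
    · subst hστ
      have : ∀ i, ∀ j ∈ univ.filter (fun j => j ≠ i),
          (if σ = Equiv.swap i j * σ then α i j * f σ else 0) = 0 := by
        intro i j hj
        rw [if_neg]
        intro h
        rw [eq_comm, mul_eq_right, Equiv.swap_eq_one_iff] at h
        exact (mem_filter.mp hj).2 h.symm
      rw [sum_congr rfl fun i _ => sum_congr rfl (this i)]
      simp
    · simp only [zero_sub, neg_mul, mul_assoc, sum_mul, ite_mul, zero_mul]
  have h2 : ∀ i, ∑ j, α i j * (f σ - f (Equiv.swap i j * σ)) =
      ∑ j with j ≠ i, α i j * (f σ - f (Equiv.swap i j * σ)) := by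
    intro i
    rw [filter_ne', ← add_sum_erase _ _ (mem_univ i), Equiv.swap_self]
    change _ * (f σ - f (1 * σ)) + _ = _
    simp
  have h3 : ∑ τ, 1 / 2 * ∑ i, ∑ j with j ≠ i, (if τ = Equiv.swap i j * σ then α i j * f τ else 0) =
      1 / 2 * ∑ i, ∑ j with j ≠ i, α i j * f (Equiv.swap i j * σ) := by
    rw [← mul_sum, sum_comm]
    congr 1
    refine sum_congr rfl fun i _ => ?_
    rw [sum_comm]
    refine sum_congr rfl fun j _ => ?_
    rw [sum_ite_eq', if_pos (mem_univ _)]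
  simp only [mulVec, dotProduct, h1, sum_sub_distrib, h3, sum_ite_eq, mem_univ, if_true]
  rw [sum_congr rfl fun i _ => h2 i]
  simp only [mul_sub, sum_sub_distrib, sum_mul, mul_assoc]

variable {α : V → V → ℝ}

lemma dotProduct_randomWalkLaplacian_mulVec (hs : ∀ i j, α i j = α j i) (h : V → ℝ) :
    2 * (h ⬝ᵥ (randomWalkLaplacian α *ᵥ h)) = walkEnergy α h := by
  have h1 : ∑ i, ∑ j, α i j * (h i - h j) * h j = -∑ i, ∑ j, α i j * (h i - h j) * h i := by
    rw [sum_comm, ← sum_neg_distrib]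
    refine sum_congr rfl fun i _ => ?_
    rw [← sum_neg_distrib]
    exact sum_congr rfl fun j _ => by rw [hs j i]; ring
  have h2 : walkEnergy α h = ∑ i, ∑ j, α i j * (h i - h j) * h i -
      ∑ i, ∑ j, α i j * (h i - h j) * h j := by
    simp only [walkEnergy, ← sum_sub_distrib]
    exact sum_congr rfl fun i _ => sum_congr rfl fun j _ => by ring
  rw [h2, h1]
  simp only [dotProduct, randomWalkLaplacian_mulVec, mul_sum, two_mul, sub_neg_eq_add,
    ← sum_add_distrib]
  exact sum_congr rfl fun i _ => sum_congr rfl fun j _ => by ring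

lemma dotProduct_interchangeLaplacian_mulVec (α : V → V → ℝ) (f : Equiv.Perm V → ℝ) :
    2 * (f ⬝ᵥ (interchangeLaplacian α *ᵥ f)) = interchangeEnergy α f := by
  have h1 : ∀ i j, α i j * (autocorrelation f 1 - autocorrelation f (Equiv.swap i j)) =
      ∑ σ, f σ * (α i j * (f σ - f (Equiv.swap i j * σ))) := by
    intro i j
    simp only [autocorrelation, ← sum_sub_distrib, mul_sum, one_mul]
    exact sum_congr rfl fun σ _ => by ring
  simp only [interchangeEnergy, h1, dotProduct, interchangeLaplacian_mulVec]
  rw [sum_congr rfl fun i _ => sum_comm, sum_comm, mul_sum]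
  refine sum_congr rfl fun σ _ => ?_
  simp only [mul_sum]
  exact sum_congr rfl fun i _ => sum_congr rfl fun j _ => by ring

lemma randomWalkLaplacian_isHermitian (hs : ∀ i j, α i j = α j i) :
    (randomWalkLaplacian α).IsHermitian := by
  ext i j
  simp only [conjTranspose_apply, randomWalkLaplacian, of_apply, star_trivial]
  by_cases h : i = j
  · subst h; rfl
  · rw [if_neg h, if_neg (Ne.symm h), hs]

lemma interchangeLaplacian_isHermitian (α : V → V → ℝ) :
    (interchangeLaplacian α).IsHermitian := by
  ext σ τ
  simp only [conjTranspose_apply, interchangeLaplacian, of_apply, star_trivial]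
  by_cases h : σ = τ
  · subst h; rfl
  · rw [if_neg h, if_neg (Ne.symm h)]
    congr 2
    refine sum_congr rfl fun i _ => sum_congr rfl fun j _ => ?_
    refine if_congr ?_ rfl rfl
    constructor
    · rintro rfl; simp
    · rintro rfl; simp

lemma interchangeEnergy_nonneg (hα : ∀ i j, 0 ≤ α i j) (f : Equiv.Perm V → ℝ) :
    0 ≤ interchangeEnergy α f := by
  refine sum_nonneg fun i _ => sum_nonneg fun j _ => mul_nonneg (hα i j) ?_
  have h := sum_sq_sub_translate f (Equiv.swap i j)
  have h0 : 0 ≤ ∑ σ, (f σ - f (Equiv.swap i j * σ)) ^ 2 := sum_nonneg fun σ _ => sq_nonneg _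
  linarith

/-- A single particle of the interchange process performs the random walk. -/
lemma sum_sum_swap_apply (hs : ∀ i j, α i j = α j i) (h : V → ℝ) (y : V) :
    1 / 2 * ∑ i, ∑ j, α i j * (h y - h (Equiv.swap i j y)) = ∑ j, α y j * (h y - h j) := by
  have hpt : ∀ i j, α i j * (h y - h (Equiv.swap i j y)) =
      (if i = y then α y j * (h y - h j) else 0) + (if j = y then α y i * (h y - h i) else 0) := by
    intro i j
    by_cases hi : i = y
    · subst hi
      by_cases hj : j = i
      · subst hj; simp
      · simp [hj]
    · by_cases hj : j = y
      · subst hj; simp [hi, hs i j]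
      · simp [hi, hj, Equiv.swap_apply_of_ne_of_ne (Ne.symm hi) (Ne.symm hj)]
  simp only [hpt, sum_add_distrib, sum_ite_eq', mem_univ, if_true]
  rw [sum_comm]
  simp
  ring

lemma exists_eigenvector_interchange (hα : ∀ i j, 0 ≤ α i j) (hn : 2 ≤ Fintype.card V) :
    (∃ f : Equiv.Perm V → ℝ, f ≠ 0 ∧ ∑ σ, f σ = 0 ∧ interchangeLaplacian α *ᵥ f =
      secondSmallestEigenvalue (interchangeLaplacian α) • f) ∧
    InterchangeGap α (secondSmallestEigenvalue (interchangeLaplacian α)) := by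
  have hpos : ∀ f, 0 ≤ f ⬝ᵥ (interchangeLaplacian α *ᵥ f) := by
    intro f
    have := interchangeEnergy_nonneg hα f
    rw [← dotProduct_interchangeLaplacian_mulVec] at this
    linarith
  have h1 : interchangeLaplacian α *ᵥ 1 = 0 := by
    ext σ
    simp [interchangeLaplacian_mulVec]
  have hcard : 2 ≤ Fintype.card (Equiv.Perm V) := by
    rw [Fintype.card_perm]
    exact hn.trans (Nat.self_le_factorial _)
  refine ⟨exists_eigenvector_secondSmallestEigenvalue (interchangeLaplacian_isHermitian α) hpos h1
    hcard, fun f hf => ?_⟩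
  have := secondSmallestEigenvalue_mul_le (interchangeLaplacian_isHermitian α) hpos h1 hcard f hf
  rw [← dotProduct_interchangeLaplacian_mulVec]
  simp only [pow_two]
  change _ * (f ⬝ᵥ f) ≤ _
  linarith

lemma exists_eigenvector_walk (hs : ∀ i j, α i j = α j i) (hα : ∀ i j, 0 ≤ α i j)
    (hn : 2 ≤ Fintype.card V) :
    (∃ h : V → ℝ, h ≠ 0 ∧ ∑ i, h i = 0 ∧ randomWalkLaplacian α *ᵥ h =
      secondSmallestEigenvalue (randomWalkLaplacian α) • h) ∧
    WalkGap α (secondSmallestEigenvalue (randomWalkLaplacian α)) := by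
  have hpos : ∀ f, 0 ≤ f ⬝ᵥ (randomWalkLaplacian α *ᵥ f) := by
    intro f
    have := walkEnergy_nonneg hα f
    rw [← dotProduct_randomWalkLaplacian_mulVec hs] at this
    linarith
  have h1 : randomWalkLaplacian α *ᵥ 1 = 0 := by
    ext σ
    simp [randomWalkLaplacian_mulVec]
  refine ⟨exists_eigenvector_secondSmallestEigenvalue (randomWalkLaplacian_isHermitian hs) hpos h1
    hn, fun f hf => ?_⟩
  have := secondSmallestEigenvalue_mul_le (randomWalkLaplacian_isHermitian hs) hpos h1 hn f hf
  rw [← dotProduct_randomWalkLaplacian_mulVec hs]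
  simp only [pow_two]
  change _ * (f ⬝ᵥ f) ≤ _
  linarith

lemma sum_perm_apply_eq_zero {h : V → ℝ} (hh : ∑ i, h i = 0) (x : V) :
    ∑ σ : Equiv.Perm V, h (σ x) = 0 := by
  have h1 : ∀ y, ∑ σ : Equiv.Perm V, h (σ y) = ∑ σ : Equiv.Perm V, h (σ x) := by
    intro y
    rw [← Equiv.sum_comp (Equiv.mulRight (Equiv.swap x y)) fun σ => h (σ y)]
    simp
  have h2 : ∑ y, ∑ σ : Equiv.Perm V, h (σ y) = 0 := by
    rw [sum_comm]
    exact sum_eq_zero fun σ _ => by rw [Equiv.sum_comp, hh]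
  rw [sum_congr rfl fun y _ => h1 y, sum_const, nsmul_eq_mul, card_univ] at h2
  refine (mul_eq_zero.mp h2).resolve_left ?_
  have : Nonempty V := ⟨x⟩
  exact_mod_cast Fintype.card_ne_zero

lemma sum_sq_pos {ι : Type*} [Fintype ι] {f : ι → ℝ} (hf : f ≠ 0) : 0 < ∑ i, f i ^ 2 := by
  obtain ⟨i, hi⟩ := Function.ne_iff.mp hf
  exact sum_pos' (fun i _ => sq_nonneg _) ⟨i, mem_univ _, by positivity [show f i ≠ 0 from hi]⟩

/-- If Poincaré inequalities transfer, the two spectral gaps agree: lifting an eigenfunction of the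
random walk along the position of one particle gives the reverse comparison. -/
theorem GapTransfers.secondSmallestEigenvalue_eq (hs : ∀ i j, α i j = α j i)
    (hα : ∀ i j, 0 ≤ α i j) (hn : 2 ≤ Fintype.card V) (ht : GapTransfers α) :
    secondSmallestEigenvalue (interchangeLaplacian α) =
      secondSmallestEigenvalue (randomWalkLaplacian α) := by
  obtain ⟨⟨f, hf0, hfsum, hf⟩, hI⟩ := exists_eigenvector_interchange hα hn
  obtain ⟨⟨h, hh0, hhsum, hh⟩, hW⟩ := exists_eigenvector_walk hs hα hn
  have hEh : walkEnergy α h =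
      2 * secondSmallestEigenvalue (randomWalkLaplacian α) * ∑ i, h i ^ 2 := by
    rw [← dotProduct_randomWalkLaplacian_mulVec hs, hh, dotProduct_smul]
    simp only [dotProduct, smul_eq_mul, pow_two]
    ring
  have hEf : interchangeEnergy α f =
      2 * secondSmallestEigenvalue (interchangeLaplacian α) * ∑ σ, f σ ^ 2 := by
    rw [← dotProduct_interchangeLaplacian_mulVec, hf, dotProduct_smul]
    simp only [dotProduct, smul_eq_mul, pow_two]
    ring
  have hg : 0 ≤ secondSmallestEigenvalue (randomWalkLaplacian α) := by
    have h1 := walkEnergy_nonneg hα h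
    have h2 := sum_sq_pos hh0
    rw [hEh] at h1
    nlinarith [nonneg_of_mul_nonneg_left h1 h2]
  apply le_antisymm
  · have hne : Nonempty V := Fintype.card_pos_iff.mp (by omega)
    obtain ⟨x⟩ := hne
    set F : Equiv.Perm V → ℝ := fun σ => h (σ x) with hF
    have hFL : interchangeLaplacian α *ᵥ F =
        secondSmallestEigenvalue (randomWalkLaplacian α) • F := by
      ext σ
      have h1 := congrFun hh (σ x)
      rw [randomWalkLaplacian_mulVec, ← sum_sum_swap_apply hs] at h1
      rw [interchangeLaplacian_mulVec]
      exact h1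
    have hF0 : F ≠ 0 := by
      obtain ⟨y, hy⟩ := Function.ne_iff.mp hh0
      refine Function.ne_iff.mpr ⟨Equiv.swap x y, ?_⟩
      simpa [hF] using hy
    have hEF := hI F (sum_perm_apply_eq_zero hhsum x)
    rw [← dotProduct_interchangeLaplacian_mulVec, hFL, dotProduct_smul] at hEF
    have h2 := sum_sq_pos hF0
    have h3 : F ⬝ᵥ F = ∑ σ, F σ ^ 2 := by simp only [dotProduct, pow_two]
    rw [h3, smul_eq_mul] at hEF
    by_contra! hlt
    nlinarith
  · have h1 := ht _ hg hW f hfsum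
    rw [hEf] at h1
    have h2 := sum_sq_pos hf0
    by_contra! hlt
    nlinarith

end Energies

/-! ### Elimination of a vertex -/

section Reduction

open Matrix

variable {V : Type*} [Fintype V] [DecidableEq V]

/-- The rates on the remaining vertices after `x` is eliminated from an electrical network with
conductances `α` (star–mesh transformation). If `x` is isolated, the correction is zero. -/
noncomputable def reducedRates (α : V → V → ℝ) (x : V) (i j : {y // y ≠ x}) : ℝ :=
  α i j + α x i * α x j / ∑ y : {y // y ≠ x}, α x y

variable {α : V → V → ℝ}

lemma reducedRates_symm (hs : ∀ i j, α i j = α j i) (x : V) (i j : {y // y ≠ x}) :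
    reducedRates α x i j = reducedRates α x j i := by
  rw [reducedRates, reducedRates, hs, mul_comm (α x i)]

lemma reducedRates_nonneg (hα : ∀ i j, 0 ≤ α i j) (x : V) (i j : {y // y ≠ x}) :
    0 ≤ reducedRates α x i j :=
  add_nonneg (hα _ _) (div_nonneg (mul_nonneg (hα _ _) (hα _ _)) (sum_nonneg fun _ _ => hα _ _))

/-- A double sum over `V` of a symmetric function vanishing on the diagonal, split at `x`. -/
lemma sum_sum_eq_subtype_ne {G : V → V → ℝ} (hG : ∀ i j, G i j = G j i) (x : V) (hx : G x x = 0) :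
    ∑ i, ∑ j, G i j = ∑ i : {y // y ≠ x}, ∑ j : {y // y ≠ x}, G i j +
      2 * ∑ i : {y // y ≠ x}, G x i := by
  simp only [Fintype.sum_eq_add_sum_subtype_ne _ x, sum_add_distrib, hx, hG _ x]
  ring

/-- Extending `h` harmonically to `x` turns the reduced energy into the original one. -/
lemma walkEnergy_reducedRates (hs : ∀ i j, α i j = α j i) (hα : ∀ i j, 0 ≤ α i j) (x : V)
    (h : {y // y ≠ x} → ℝ) :
    ∃ H : V → ℝ, (∀ y : {y // y ≠ x}, H y = h y) ∧
      walkEnergy α H = walkEnergy (reducedRates α x) h := by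
  set a := ∑ y : {y // y ≠ x}, α x y with ha
  set m := (∑ y : {y // y ≠ x}, α x y * h y) / a with hm
  refine ⟨fun y => if hy : y ≠ x then h ⟨y, hy⟩ else m, fun y => dif_pos y.2, ?_⟩
  rw [walkEnergy, sum_sum_eq_subtype_ne (fun i j => by rw [hs]; ring) x (by simp)]
  have h1 : ∀ y : {y // y ≠ x}, (if hy : (y : V) ≠ x then h ⟨y, hy⟩ else m) = h y := fun y => by
    exact dif_pos y.2
  simp only [h1]
  simp only [walkEnergy, reducedRates, add_mul, sum_add_distrib, ← ha]
  congr 1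
  simp only [ne_eq, not_true_eq_false, dite_false]
  have hexp1 : ∑ y : {y // y ≠ x}, α x y * (m - h y) ^ 2 = a * m ^ 2 -
      2 * m * ∑ y : {y // y ≠ x}, α x y * h y + ∑ y : {y // y ≠ x}, α x y * h y ^ 2 := by
    rw [ha, sum_mul, mul_sum, ← sum_sub_distrib, ← sum_add_distrib]
    exact sum_congr rfl fun y _ => by ring
  have hexp2 : ∑ i : {y // y ≠ x}, ∑ j : {y // y ≠ x}, α x i * α x j / a * (h i - h j) ^ 2 =
      2 * (a * (∑ y : {y // y ≠ x}, α x y * h y ^ 2) -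
        (∑ y : {y // y ≠ x}, α x y * h y) ^ 2) / a := by
    have h2 : ∀ i j : {y // y ≠ x}, α x i * α x j / a * (h i - h j) ^ 2 =
        ((α x i * h i ^ 2) * α x j + α x i * (α x j * h j ^ 2) -
          2 * ((α x i * h i) * (α x j * h j))) / a := fun i j => by ring
    simp only [h2, ← sum_div, sum_sub_distrib, sum_add_distrib, ← mul_sum, ← sum_mul, ← ha]
    ring
  rw [hexp1, hexp2]
  by_cases h0 : a = 0
  · have h3 : ∀ y : {y // y ≠ x}, α x y = 0 := fun y =>
      (sum_eq_zero_iff_of_nonneg fun (y : {y // y ≠ x}) _ => hα x y).mp h0 y (mem_univ _)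
    simp [h0, h3]
  · rw [hm]
    field_simp
    ring

lemma WalkGap.reducedRates (hs : ∀ i j, α i j = α j i) (hα : ∀ i j, 0 ≤ α i j) {g : ℝ}
    (hg : 0 ≤ g) (hW : WalkGap α g) (x : V) : WalkGap (reducedRates α x) g := by
  intro h hh
  obtain ⟨H, hH, hE⟩ := walkEnergy_reducedRates hs hα x h
  rw [← hE]
  set n : ℝ := (Fintype.card V : ℝ)
  have hn : n ≠ 0 := by
    have : Nonempty V := ⟨x⟩
    exact Nat.cast_ne_zero.mpr Fintype.card_ne_zero
  set M := (∑ i, H i) / n with hM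
  have h1 := hW (fun i => H i - M) (by
    rw [sum_sub_distrib, sum_const, card_univ, nsmul_eq_mul, hM]
    field_simp
    ring)
  have h2 : walkEnergy α (fun i => H i - M) = walkEnergy α H := by
    simp [walkEnergy]
  have h3 : ∑ y, h y ^ 2 ≤ ∑ i, (H i - M) ^ 2 := by
    rw [Fintype.sum_eq_add_sum_subtype_ne _ x]
    have h4 : ∑ y : {y // y ≠ x}, (H y - M) ^ 2 = ∑ y, h y ^ 2 - 2 * M * ∑ y, h y +
        ∑ _y : {y // y ≠ x}, M ^ 2 := by
      rw [mul_sum, ← sum_sub_distrib, ← sum_add_distrib]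
      exact sum_congr rfl fun y _ => by rw [hH]; ring
    rw [h4, hh]
    have h5 : 0 ≤ ∑ _y : {y // y ≠ x}, M ^ 2 := sum_nonneg fun _ _ => sq_nonneg _
    nlinarith [sq_nonneg (H x - M)]
  rw [h2] at h1
  exact (mul_le_mul_of_nonneg_left h3 (by linarith)).trans h1

/-- The octopus inequality in terms of energies: eliminating a vertex with at most three neighbours
does not increase the energy of the interchange process. -/
lemma sum_reducedRates_le_interchangeEnergy (hs : ∀ i j, α i j = α j i) (hα : ∀ i j, 0 ≤ α i j)
    (x : V) (hcard : #{y | y ≠ x ∧ α x y ≠ 0} ≤ 3) (f : Equiv.Perm V → ℝ) :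
    ∑ i : {y // y ≠ x}, ∑ j : {y // y ≠ x}, reducedRates α x i j *
      (autocorrelation f 1 - autocorrelation f (Equiv.swap (i : V) j)) ≤ interchangeEnergy α f := by
  have hself : Equiv.swap x x = (1 : Equiv.Perm V) := Equiv.swap_self x
  rw [interchangeEnergy, sum_sum_eq_subtype_ne (fun i j => by rw [hs, Equiv.swap_comm]) x
    (by rw [hself]; ring)]
  set D : V → V → ℝ := fun i j => autocorrelation f 1 - autocorrelation f (Equiv.swap i j) with hD
  change ∑ i : {y // y ≠ x}, ∑ j : {y // y ≠ x}, reducedRates α x i j * D i j ≤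
    ∑ i : {y // y ≠ x}, ∑ j : {y // y ≠ x}, α i j * D i j + 2 * ∑ i : {y // y ≠ x}, α x i * D x i
  set a := ∑ y : {y // y ≠ x}, α x y with ha
  simp only [reducedRates, add_mul, sum_add_distrib, ← ha]
  gcongr
  have ha0 : 0 ≤ a := sum_nonneg fun _ _ => hα _ _
  rcases ha0.eq_or_lt with h0 | hpos
  · have h3 : ∀ y : {y // y ≠ x}, α x y = 0 := fun y =>
      (sum_eq_zero_iff_of_nonneg fun (y : {y // y ≠ x}) _ => hα x y).mp h0.symm y (mem_univ _)
    simp [h3]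
  set c : V → ℝ := fun y => if y = x then -a else α x y with hc
  have hcx : c x = -a := by simp [hc]
  have hcy : ∀ y : {y // y ≠ x}, c y = α x y := fun y => by simp [hc, y.2]
  have hcsum : ∑ i, c i = 0 := by
    rw [Fintype.sum_eq_add_sum_subtype_ne _ x, hcx, sum_congr rfl fun y _ => hcy y, ← ha]
    ring
  have hoct := octopus_inequality hcsum x (fun y hy => by simpa [hc, hy] using hα x y) (by
    refine le_trans (card_le_card ?_) hcard
    intro y
    simp only [mem_filter, mem_univ, true_and, hc]
    rintro ⟨hy, h⟩
    rw [if_neg hy] at h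
    exact ⟨hy, h⟩) f
  have h1 : ∑ i, ∑ j, c i * c j * D i j =
      -∑ i, ∑ j, c i * c j * autocorrelation f (Equiv.swap i j) := by
    have h2 : ∑ i, ∑ j, c i * c j * autocorrelation f 1 = 0 := by
      simp only [← sum_mul, ← mul_sum, hcsum, mul_zero, zero_mul, sum_const_zero]
    simp only [hD, mul_sub, sum_sub_distrib, h2, zero_sub]
  rw [sum_sum_eq_subtype_ne (fun i j => by simp only [hD]; rw [Equiv.swap_comm]; ring) x
    (by simp only [hD]; rw [hself]; ring)] at h1
  simp only [hcx, hcy] at h1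
  have h4 : ∑ i : {y // y ≠ x}, ∑ j : {y // y ≠ x}, α x i * α x j / a * D i j =
      (∑ i : {y // y ≠ x}, ∑ j : {y // y ≠ x}, α x i * α x j * D i j) / a := by
    simp only [sum_div]
    exact sum_congr rfl fun i _ => sum_congr rfl fun j _ => by ring
  have h5 : ∑ i : {y // y ≠ x}, -a * α x i * D x i = -a * ∑ i : {y // y ≠ x}, α x i * D x i := by
    rw [mul_sum]
    exact sum_congr rfl fun j _ => by ring
  rw [h4, div_le_iff₀ hpos]
  rw [h5] at h1
  linarith

/-- Summing over the right cosets of the stabiliser of `x`, a Poincaré inequality for the reduced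
rates bounds every function whose sum over each coset vanishes. -/
lemma InterchangeGap.sum_sq_le {x : V} {β : {y // y ≠ x} → {y // y ≠ x} → ℝ} {g : ℝ}
    (hI : InterchangeGap β g) {f : Equiv.Perm V → ℝ}
    (hf : ∀ i, ∑ σ : Equiv.Perm V, (if σ i = x then f σ else 0) = 0) :
    2 * g * ∑ σ, f σ ^ 2 ≤ ∑ i : {y // y ≠ x}, ∑ j : {y // y ≠ x}, β i j *
      (autocorrelation f 1 - autocorrelation f (Equiv.swap (i : V) j)) := by
  set F : Equiv.Perm V → Equiv.Perm {y // y ≠ x} → ℝ :=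
    fun τ ρ => f (Equiv.Perm.ofSubtype ρ * τ) with hF
  have hFsum : ∀ τ, ∑ ρ, F τ ρ = 0 := by
    intro τ
    have h1 : ∑ ρ : Equiv.Perm {y // y ≠ x}, F τ ρ =
        ∑ σ : Equiv.Perm V, if σ x = x then f (σ * τ) else 0 := by
      rw [← sum_filter]
      refine sum_bij (fun ρ _ => Equiv.Perm.ofSubtype ρ) ?_ ?_ ?_ ?_
      · intro ρ _
        simpa using Equiv.Perm.ofSubtype_apply_of_not_mem ρ (a := x) (by simp)
      · intro ρ _ ρ' _ h
        exact Equiv.Perm.ofSubtype_injective h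
      · intro σ hσ
        have hσx : σ x = x := by simpa using hσ
        refine ⟨σ.subtypePerm fun y => ?_, mem_univ _, Equiv.Perm.ofSubtype_subtypePerm _ ?_⟩
        · rw [ne_eq, ne_eq, ← σ.apply_eq_iff_eq (x := y), hσx]
        · intro y hy hyx
          exact hy (by rw [hyx, hσx])
      · intro ρ _; rfl
    have h2 := hf (τ⁻¹ x)
    rw [← Equiv.sum_comp (Equiv.mulRight τ) fun σ => if σ (τ⁻¹ x) = x then f σ else 0] at h2
    rw [h1]
    refine Eq.trans ?_ h2
    simp
  have hauto : ∀ ρ, ∑ τ, autocorrelation (F τ) ρ =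
      Fintype.card (Equiv.Perm {y // y ≠ x}) * autocorrelation f (Equiv.Perm.ofSubtype ρ) := by
    intro ρ
    simp only [autocorrelation, hF]
    rw [sum_comm, ← nsmul_eq_mul, ← card_univ, ← sum_const]
    refine sum_congr rfl fun ρ' _ => ?_
    rw [← Equiv.sum_comp (Equiv.mulLeft (Equiv.Perm.ofSubtype ρ'))
      fun σ => f σ * f (Equiv.Perm.ofSubtype ρ * σ)]
    simp [mul_assoc]
  have hsq : ∑ τ, ∑ ρ, F τ ρ ^ 2 =
      Fintype.card (Equiv.Perm {y // y ≠ x}) * ∑ σ, f σ ^ 2 := by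
    have := hauto 1
    simpa [autocorrelation, pow_two] using this
  have hsum := sum_le_sum fun τ (_ : τ ∈ univ) => hI (F τ) (hFsum τ)
  have hE : ∑ τ, interchangeEnergy β (F τ) = Fintype.card (Equiv.Perm {y // y ≠ x}) *
      ∑ i : {y // y ≠ x}, ∑ j : {y // y ≠ x}, β i j *
      (autocorrelation f 1 - autocorrelation f (Equiv.swap (i : V) j)) := by
    simp only [interchangeEnergy]
    rw [sum_comm, mul_sum]
    refine sum_congr rfl fun i _ => ?_
    rw [sum_comm, mul_sum]
    refine sum_congr rfl fun j _ => ?_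
    rw [← mul_sum, sum_sub_distrib, hauto, hauto, map_one, Equiv.Perm.ofSubtype_swap_eq]
    ring
  rw [hE, ← mul_sum, hsq] at hsum
  have hc : (0 : ℝ) < Fintype.card (Equiv.Perm {y // y ≠ x}) :=
    Nat.cast_pos.mpr Fintype.card_pos
  refine le_of_mul_le_mul_left ?_ hc
  linarith

/-- The marginal of an eigenfunction of the interchange process at the position of particle `i` is
an eigenfunction of the random walk. -/
lemma randomWalkLaplacian_mulVec_marginal (hs : ∀ i j, α i j = α j i) {f : Equiv.Perm V → ℝ}
    {s : ℝ} (hf : interchangeLaplacian α *ᵥ f = s • f) (i : V) :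
    (randomWalkLaplacian α *ᵥ fun y => ∑ σ : Equiv.Perm V, if σ i = y then f σ else 0) =
      s • fun y => ∑ σ : Equiv.Perm V, if σ i = y then f σ else 0 := by
  ext y
  rw [randomWalkLaplacian_mulVec,
    ← sum_sum_swap_apply hs (fun y => ∑ σ : Equiv.Perm V, if σ i = y then f σ else 0)]
  have h1 : ∀ a b, (∑ σ : Equiv.Perm V, if σ i = Equiv.swap a b y then f σ else 0) =
      ∑ σ : Equiv.Perm V, if σ i = y then f (Equiv.swap a b * σ) else 0 := by
    intro a b
    rw [← Equiv.sum_comp (Equiv.mulLeft (Equiv.swap a b))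
      fun σ => if σ i = Equiv.swap a b y then f σ else 0]
    simp
  have h2 : ∀ σ, s * f σ = 1 / 2 * ∑ a, ∑ b, α a b * (f σ - f (Equiv.swap a b * σ)) := by
    intro σ
    rw [← interchangeLaplacian_mulVec, hf]; rfl
  simp only [h1, Pi.smul_apply, smul_eq_mul]
  have h3 : ∀ σ : Equiv.Perm V, s * (if σ i = y then f σ else 0) =
      1 / 2 * ∑ a, ∑ b, α a b * ((if σ i = y then f σ else 0) -
        if σ i = y then f (Equiv.swap a b * σ) else 0) := by
    intro σ
    split_ifs
    · exact h2 σ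
    · simp
  symm
  rw [mul_sum, sum_congr rfl fun σ _ => h3 σ, ← mul_sum, sum_comm]
  congr 1
  refine sum_congr rfl fun a _ => ?_
  rw [sum_comm]
  refine sum_congr rfl fun b _ => ?_
  rw [← mul_sum, sum_sub_distrib]

/-- The induction step: Poincaré inequalities transfer for `α` if they do after eliminating a vertex
with at most three neighbours. An eigenfunction at the gap of the interchange process either has a
nonzero one-particle marginal, which is an eigenfunction of the random walk, or sums to zero over
all right cosets of the stabiliser of `x`, so that the reduced process and the octopus inequality
bound its energy. -/
theorem GapTransfers.of_reducedRates (hs : ∀ i j, α i j = α j i) (hα : ∀ i j, 0 ≤ α i j) (x : V)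
    (hcard : #{y | y ≠ x ∧ α x y ≠ 0} ≤ 3) (ht : GapTransfers (reducedRates α x)) :
    GapTransfers α := by
  intro g hg hW
  by_cases hn : 2 ≤ Fintype.card V
  swap
  · intro f hf
    have hsub : Subsingleton V := Fintype.card_le_one_iff_subsingleton.mp (by omega)
    have h0 : ∀ σ, f σ = 0 := fun σ => by
      rwa [Fintype.sum_subsingleton _ σ] at hf
    simp only [h0]
    simpa using interchangeEnergy_nonneg hα f
  obtain ⟨⟨f, hf0, hfsum, hf⟩, hI⟩ := exists_eigenvector_interchange hα hn
  set s := secondSmallestEigenvalue (interchangeLaplacian α) with hs'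
  suffices hgs : g ≤ s by
    intro F hF
    refine le_trans ?_ (hI F hF)
    have : 0 ≤ ∑ σ, F σ ^ 2 := sum_nonneg fun _ _ => sq_nonneg _
    nlinarith
  by_cases hmarg : ∀ i y, ∑ σ : Equiv.Perm V, (if σ i = y then f σ else 0) = 0
  · have h1 := (ht g hg (hW.reducedRates hs hα hg x)).sum_sq_le fun i => hmarg i x
    have h2 := sum_reducedRates_le_interchangeEnergy hs hα x hcard f
    rw [← dotProduct_interchangeLaplacian_mulVec, hf, dotProduct_smul] at h2
    have h3 : f ⬝ᵥ f = ∑ σ, f σ ^ 2 := by simp only [dotProduct, pow_two]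
    rw [h3, smul_eq_mul] at h2
    have h4 := sum_sq_pos hf0
    by_contra! hlt
    nlinarith
  · push Not at hmarg
    obtain ⟨i, y, hy⟩ := hmarg
    set h : V → ℝ := fun y => ∑ σ : Equiv.Perm V, if σ i = y then f σ else 0 with hh
    have hsum : ∑ y, h y = 0 := by
      rw [hh, sum_comm]
      simpa using hfsum
    have h1 := hW h hsum
    rw [← dotProduct_randomWalkLaplacian_mulVec hs, randomWalkLaplacian_mulVec_marginal hs hf,
      dotProduct_smul] at h1
    have h3 : h ⬝ᵥ h = ∑ y, h y ^ 2 := by simp only [dotProduct, pow_two]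
    rw [h3, smul_eq_mul] at h1
    have h4 := sum_sq_pos (f := h) (Function.ne_iff.mpr ⟨y, hy⟩)
    by_contra! hlt
    nlinarith

end Reduction

/-! ### Graphs reducible by elimination -/

section Transport

variable {V W : Type*} [Fintype V] [DecidableEq V] [Fintype W] [DecidableEq W]

lemma GapTransfers.comap_equiv {α : V → V → ℝ} (e : W ≃ V)
    (ht : GapTransfers fun i j => α (e i) (e j)) : GapTransfers α := by
  intro g hg hW f hf
  have hW' : WalkGap (fun i j => α (e i) (e j)) g := by
    intro h hh
    have h1 := hW (h ∘ e.symm) (by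
      rw [← e.sum_comp]
      simpa using hh)
    rw [← e.sum_comp] at h1
    simp only [walkEnergy, ← e.sum_comp (fun _ => (_ : ℝ))] at h1 ⊢
    simpa using h1
  have hauto : ∀ ρ : Equiv.Perm W, autocorrelation (fun σ => f (e.permCongr σ)) ρ =
      autocorrelation f (e.permCongr ρ) := by
    intro ρ
    simp only [autocorrelation]
    rw [← e.permCongr.sum_comp]
    refine sum_congr rfl fun σ _ => ?_
    rw [← Equiv.permCongr_mul]
  have h1 := ht g hg hW' (fun σ => f (e.permCongr σ)) (by
    rw [e.permCongr.sum_comp]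
    exact hf)
  have hone : e.permCongr 1 = 1 := by ext; simp
  have hswap : ∀ i j, e.permCongr (Equiv.swap i j) = Equiv.swap (e i) (e j) := by
    intro i j
    rw [Equiv.permCongr_def]
    simp
  simp only [interchangeEnergy, hauto, hone, hswap] at h1
  rw [e.permCongr.sum_comp fun σ => f σ ^ 2] at h1
  have h2 : interchangeEnergy α f = ∑ i, ∑ j, α (e i) (e j) *
      (autocorrelation f 1 - autocorrelation f (Equiv.swap (e i) (e j))) := by
    rw [interchangeEnergy, ← e.sum_comp]
    exact sum_congr rfl fun i _ => (e.sum_comp _).symm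
  rw [h2]
  exact h1

lemma GapTransfers.of_subsingleton [Subsingleton V] {α : V → V → ℝ} (hα : ∀ i j, 0 ≤ α i j) :
    GapTransfers α := by
  intro g _ _ f hf
  have h0 : ∀ σ, f σ = 0 := fun σ => by
    rwa [Fintype.sum_subsingleton _ σ] at hf
  simp only [h0]
  simpa using interchangeEnergy_nonneg hα f

/-- Poincaré inequalities transfer for all rates on the graph `G`; diagonal rates are irrelevant and
unconstrained. -/
def GapTransfersOn (G : SimpleGraph V) : Prop :=
  ∀ α : V → V → ℝ, (∀ i j, α i j = α j i) → (∀ i j, 0 ≤ α i j) →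
    (∀ i j, i ≠ j → ¬ G.Adj i j → α i j = 0) → GapTransfers α

lemma GapTransfersOn.aldousHolds {G : SimpleGraph V} (h : GapTransfersOn G)
    (hn : 2 ≤ Fintype.card V) : AldousHolds G := fun _ hα _ =>
  (h _ hα.symm hα.nonneg fun i j _ => hα.eq_zero_of_not_adj i j).secondSmallestEigenvalue_eq
    hα.symm hα.nonneg hn

lemma GapTransfersOn.of_equiv {G : SimpleGraph V} {H : SimpleGraph W} (e : W ≃ V)
    (he : ∀ i j, G.Adj (e i) (e j) → H.Adj i j) (h : GapTransfersOn H) : GapTransfersOn G :=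
  fun _ hs hα h0 => GapTransfers.comap_equiv e <| h _ (fun _ _ => hs _ _) (fun _ _ => hα _ _)
    fun i j hij hadj => h0 _ _ (e.injective.ne hij) fun hG => hadj (he i j hG)

/-- A vertex with at most three neighbours, any two of which are adjacent in the remaining graph,
can be eliminated: the reduced rates live on the remaining graph. -/
lemma GapTransfersOn.of_eliminate {G : SimpleGraph V} {x : V} {G' : SimpleGraph {y // y ≠ x}}
    (s : Finset V) (hs : s.card ≤ 3) (hxs : ∀ y, G.Adj x y → y ∈ s)
    (hG : ∀ i j : {y // y ≠ x}, G.Adj i j → G'.Adj i j)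
    (hx : ∀ i j : {y // y ≠ x}, i ≠ j → G.Adj x i → G.Adj x j → G'.Adj i j)
    (h : GapTransfersOn G') : GapTransfersOn G := by
  intro α hsym hα h0
  refine GapTransfers.of_reducedRates hsym hα x ?_
    (h _ (reducedRates_symm hsym x) (reducedRates_nonneg hα x) ?_)
  · refine (card_le_card fun y hy => ?_).trans hs
    simp only [mem_filter, mem_univ, true_and] at hy
    by_contra hys
    exact hy.2 (h0 x y hy.1.symm fun hadj => hys (hxs y hadj))
  · intro i j hij hadj
    have h1 : α i j = 0 := h0 _ _ (Subtype.coe_ne_coe.mpr hij) fun h => hadj (hG i j h)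
    have h2 : α x i * α x j = 0 := by
      by_cases hi : G.Adj x i
      · have hj : ¬ G.Adj x j := fun hj => hadj (hx i j hij hi hj)
        rw [h0 x j j.2.symm hj, mul_zero]
      · rw [h0 x i i.2.symm hi, zero_mul]
    rw [reducedRates, h1, h2]
    simp

end Transport

lemma gapTransfersOn_of_card_le_four {V : Type*} [Fintype V] [DecidableEq V] (G : SimpleGraph V)
    (hV : Fintype.card V ≤ 4) : GapTransfersOn G := by
  induction hn : Fintype.card V generalizing V with
  | zero =>
    have : Subsingleton V := Fintype.card_le_one_iff_subsingleton.mp (by omega)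
    exact fun α _ hα _ => GapTransfers.of_subsingleton hα
  | succ n ih =>
    obtain ⟨x⟩ : Nonempty V := Fintype.card_pos_iff.mp (by omega)
    have hcard : Fintype.card {y // y ≠ x} = n := by
      rw [Fintype.card_subtype_compl, Fintype.card_subtype_eq]
      omega
    refine GapTransfersOn.of_eliminate (x := x) (G' := ⊤) (univ.erase x) ?_ ?_ ?_ ?_
      (ih ⊤ (by omega) hcard)
    · rw [card_erase_of_mem (mem_univ x), card_univ]
      omega
    · exact fun y hy => mem_erase.mpr ⟨hy.ne', mem_univ _⟩
    · exact fun i j h => fun hij => h.ne (congrArg _ hij)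
    · exact fun i j h _ _ => h

/-- Vertices that are pairwise nonadjacent and each joined to a clique on three vertices can be
eliminated one after the other. -/
lemma GapTransfersOn.sum {V W : Type*} [Fintype V] [DecidableEq V] [Fintype W] [DecidableEq W]
    {G : SimpleGraph V} (hG : GapTransfersOn G) (K : W → Finset V)
    (hK : ∀ w, G.IsNClique 3 (K w)) (H : SimpleGraph (V ⊕ W))
    (hll : ∀ a b, H.Adj (Sum.inl a) (Sum.inl b) ↔ G.Adj a b)
    (hrl : ∀ w a, H.Adj (Sum.inr w) (Sum.inl a) → a ∈ K w)
    (hrr : ∀ w w', ¬ H.Adj (Sum.inr w) (Sum.inr w')) : GapTransfersOn H := by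
  induction hn : Fintype.card W generalizing W with
  | zero =>
    have : IsEmpty W := Fintype.card_eq_zero_iff.mp hn
    exact GapTransfersOn.of_equiv (Equiv.sumEmpty V W).symm (fun i j h => (hll i j).mp h) hG
  | succ n ih =>
    obtain ⟨w⟩ : Nonempty W := Fintype.card_pos_iff.mp (by omega)
    have hcard : Fintype.card {w' // w' ≠ w} = n := by
      rw [Fintype.card_subtype_compl, Fintype.card_subtype_eq]
      omega
    refine GapTransfersOn.of_eliminate (x := Sum.inr w) (G' := H.comap Subtype.val)
      ((K w).map Function.Embedding.inl) ?_ ?_ (fun i j h => h) ?_ ?_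
    · rw [card_map, (hK w).card_eq]
    · rintro (a | w') h
      · simpa using hrl w a h
      · exact absurd h (hrr _ _)
    · rintro ⟨a | w', hi⟩ ⟨b | w'', hj⟩ hij hai hbj
      · refine (hll a b).mpr ((hK w).isClique (hrl w a hai) (hrl w b hbj) ?_)
        rintro rfl
        exact hij rfl
      · exact absurd hbj (hrr _ _)
      · exact absurd hai (hrr _ _)
      · exact absurd hai (hrr _ _)
    · let e : V ⊕ {w' // w' ≠ w} ≃ {y : V ⊕ W // y ≠ Sum.inr w} :=
        Equiv.ofBijective
          (Sum.elim (fun a => ⟨Sum.inl a, Sum.inl_ne_inr⟩)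
            fun w' => ⟨Sum.inr w', fun h => w'.2 (Sum.inr_injective h)⟩) (by
          constructor
          · rintro (a | ⟨w', hw⟩) (b | ⟨w'', hw'⟩) h <;> simp_all
          · rintro ⟨a | w', h⟩
            · exact ⟨Sum.inl a, rfl⟩
            · exact ⟨Sum.inr ⟨w', fun hw => h (by rw [hw])⟩, rfl⟩)
      refine GapTransfersOn.of_equiv (H := H.comap (Sum.map id Subtype.val)) e ?_
        (ih (W := {w' // w' ≠ w}) (fun w' => K w') (fun w' => hK w') _
          (fun a b => hll a b) (fun w' a => hrl w' a) (fun w' w'' => hrr w' w'') hcard)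
      rintro (a | w') (b | w'') h <;> exact h

lemma GapTransfersOn.next {S : NestedStage} [Fintype S.V] [DecidableEq S.V]
    (h : GapTransfersOn S.graph) (N : ℕ) [Fintype (S.next N).V] [DecidableEq (S.next N).V] :
    GapTransfersOn (S.next N).graph := by
  classical
  have hW : Finite S.NewTriangle := Subtype.finite
  let _ : Fintype S.NewTriangle := Fintype.ofFinite _
  exact GapTransfersOn.of_equiv (V := (S.next N).V) (G := (S.next N).graph)
    (W := S.V ⊕ S.NewTriangle × Fin N) (H := (S.next N).graph) (Equiv.refl _) (fun i j h => h)
    (GapTransfersOn.sum h (fun t => t.1.1) (fun t => t.1.2.1) _ (fun _ _ => Iff.rfl)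
      (fun _ _ h => h) (fun _ _ h => h))

lemma gapTransfersOn_nestedStage (N D : ℕ) : ∀ [Fintype (nestedStage N D).V]
    [DecidableEq (nestedStage N D).V], GapTransfersOn (nestedStage N D).graph := by
  classical
  induction D with
  | zero =>
    intro _ _
    refine gapTransfersOn_of_card_le_four _ ?_
    have h : Fintype.card (nestedStage N 0).V = Fintype.card (Fin 3) :=
      Fintype.card_congr (Equiv.refl (Fin 3))
    rw [h, Fintype.card_fin]
    norm_num
  | succ D ih =>
    intro _ _
    have : Finite (nestedStage N D).V := finite_nestedVertex D N
    let _ : Fintype (nestedStage N D).V := Fintype.ofFinite _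
    exact @GapTransfersOn.next (nestedStage N D) _ _ ih N ‹_› ‹_›

lemma SimpleGraph.IsTree.gapTransfersOn {V : Type*} [Fintype V] [DecidableEq V]
    {G : SimpleGraph V} (hG : G.IsTree) : GapTransfersOn G := by
  classical
  induction hn : Fintype.card V generalizing V with
  | zero =>
    have : Subsingleton V := Fintype.card_le_one_iff_subsingleton.mp (by omega)
    exact fun α _ hα _ => GapTransfers.of_subsingleton hα
  | succ n ih =>
    rcases subsingleton_or_nontrivial V with _ | _
    · exact fun α _ hα _ => GapTransfers.of_subsingleton hα
    obtain ⟨x, hx⟩ := hG.exists_vert_degree_one_of_nontrivial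
    have hcard : Fintype.card {y // y ≠ x} = n := by
      rw [Fintype.card_subtype_compl, Fintype.card_subtype_eq]
      omega
    obtain ⟨u, hu, huniq⟩ := SimpleGraph.degree_eq_one_iff_existsUnique_adj.mp hx
    refine GapTransfersOn.of_eliminate (x := x) (G' := G.comap Subtype.val) {u} (by simp) ?_
      (fun i j h => h) ?_ (ih ⟨?_, ?_⟩ hcard)
    · exact fun y hy => mem_singleton.mpr (huniq y hy)
    · exact fun i j hij hi hj => absurd (Subtype.ext ((huniq i hi).trans (huniq j hj).symm)) hij
    · exact hG.connected.induce_compl_singleton_of_degree_eq_one hx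
    · exact hG.isAcyclic.comap (SimpleGraph.Hom.comap Subtype.val G) Subtype.val_injective

/-- If every vertex lies on a new triangle, then this holds at the next stage as well: any new
vertex spans a new triangle with two of the three vertices it is joined to. -/
lemma NestedStage.exists_newTriangle_mem_next {S : NestedStage} {N : ℕ} (hN : 1 ≤ N)
    (h : ∀ v, ∃ t : S.NewTriangle, v ∈ t.1) (v : (S.next N).V) :
    ∃ t : (S.next N).NewTriangle, v ∈ t.1 := by
  classical
  have hnew : ∀ (t : S.NewTriangle) (k : Fin N) (a b : S.V), a ∈ t.1 → b ∈ t.1 → a ≠ b →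
      ∃ s : (S.next N).NewTriangle, Sum.inr (t, k) ∈ s.1 ∧ Sum.inl a ∈ s.1 := by
    intro t k a b ha hb hab
    let s : Finset (S.V ⊕ S.NewTriangle × Fin N) := {Sum.inr (t, k), Sum.inl a, Sum.inl b}
    have hr : Sum.inr (t, k) ∈ s := by simp [s]
    have hl : Sum.inl a ∈ s := by simp [s]
    refine ⟨⟨s, ?_, fun hs => ?_⟩, hr, hl⟩
    · exact (SimpleGraph.is3Clique_iff (α := S.V ⊕ S.NewTriangle × Fin N)
        (G := (S.next N).graph)).mpr ⟨Sum.inr (t, k), Sum.inl a, Sum.inl b, ha, hb,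
        t.2.1.isClique ha hb hab, rfl⟩
    -- The vertex `inr (t, k)` is isolated in the preceding stage.
    · have hadj : (S.graph.map Function.Embedding.inl).Adj
          (Sum.inr (t, k) : S.V ⊕ S.NewTriangle × Fin N) (Sum.inl a) :=
        hs.isClique hr hl Sum.inr_ne_inl
      obtain ⟨u, w, -, hu, -⟩ := (SimpleGraph.map_adj _ _ _ _).mp hadj
      exact Sum.inl_ne_inr hu
  rcases v with a | ⟨t, k⟩
  · obtain ⟨t, ht⟩ := h a
    obtain ⟨b, hb, hba⟩ := exists_mem_ne (by rw [t.2.1.card_eq]; norm_num) a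
    obtain ⟨s, -, hs⟩ := hnew t ⟨0, hN⟩ a b ht hb hba.symm
    exact ⟨s, hs⟩
  · obtain ⟨a, ha, b, hb, hab⟩ := one_lt_card.mp (show 1 < #t.1 by rw [t.2.1.card_eq]; norm_num)
    obtain ⟨s, hs, -⟩ := hnew t k a b ha hb hab
    exact ⟨s, hs⟩

lemma exists_newTriangle_mem {N : ℕ} (hN : 1 ≤ N) (D : ℕ) (v : (nestedStage N D).V) :
    ∃ t : (nestedStage N D).NewTriangle, v ∈ t.1 := by
  induction D with
  | zero =>
    refine ⟨⟨(univ : Finset (Fin 3)), ?_, fun h => ?_⟩, mem_univ (α := Fin 3) v⟩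
    · exact ⟨fun a _ b _ h => h, card_fin 3⟩
    · exact (SimpleGraph.bot_adj (0 : Fin 3) 1).mp
        (h.isClique (mem_univ (0 : Fin 3)) (mem_univ (1 : Fin 3)) (zero_ne_one (α := Fin 3)))
  | succ D ih => exact NestedStage.exists_newTriangle_mem_next hN ih v

/-- A tree embeds into a nested triangulation: a leaf is mapped to a vertex added to a new triangle
through the image of its neighbour. -/
lemma SimpleGraph.IsTree.exists_isContained_nestedTriangulation {V : Type*} [Fintype V]
    {G : SimpleGraph V} (hG : G.IsTree) : ∃ D, G.IsContained (nestedTriangulation D 1) := by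
  classical
  induction hn : Fintype.card V generalizing V with
  | zero =>
    have := hG.connected.nonempty
    exact absurd hn Fintype.card_ne_zero
  | succ n ih =>
    rcases subsingleton_or_nontrivial V with _ | _
    · exact ⟨0, ⟨⟨⟨fun _ => (0 : Fin 3), fun h => absurd (Subsingleton.elim _ _) h.ne⟩,
        fun _ _ _ => Subsingleton.elim _ _⟩⟩⟩
    obtain ⟨x, hx⟩ := hG.exists_vert_degree_one_of_nontrivial
    have hcard : Fintype.card {y // y ≠ x} = n := by
      rw [Fintype.card_subtype_compl, Fintype.card_subtype_eq]
      omega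
    obtain ⟨u, hu, huniq⟩ := SimpleGraph.degree_eq_one_iff_existsUnique_adj.mp hx
    obtain ⟨D, ⟨φ⟩⟩ := ih (G := G.comap (Subtype.val : {y // y ≠ x} → V))
      ⟨hG.connected.induce_compl_singleton_of_degree_eq_one hx,
        hG.isAcyclic.comap (SimpleGraph.Hom.comap Subtype.val G) Subtype.val_injective⟩ hcard
    obtain ⟨t, ht⟩ := exists_newTriangle_mem le_rfl D (φ ⟨u, hu.ne'⟩)
    let ψ : V → NestedVertex (D + 1) 1 := fun y =>
      if hy : y ≠ x then Sum.inl (φ ⟨y, hy⟩) else Sum.inr (t, 0)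
    have hψ : ∀ y (hy : y ≠ x), ψ y = Sum.inl (φ ⟨y, hy⟩) := fun y hy => dif_pos hy
    have hψx : ψ x = Sum.inr (t, 0) := dif_neg (not_not.mpr rfl)
    refine ⟨D + 1, ⟨⟨⟨ψ, ?_⟩, ?_⟩⟩⟩
    · intro a b hab
      by_cases ha : a = x
      · subst ha
        obtain rfl := huniq b hab
        rw [hψx, hψ b hab.ne']
        exact ht
      · by_cases hb : b = x
        · subst hb
          obtain rfl := huniq a hab.symm
          rw [hψx, hψ a hab.ne]
          exact ht
        · rw [hψ a ha, hψ b hb]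
          exact φ.toHom.map_adj (v := ⟨a, ha⟩) (w := ⟨b, hb⟩) hab
    · intro a b hab
      change ψ a = ψ b at hab
      by_cases ha : a = x
      · by_cases hb : b = x
        · rw [ha, hb]
        · rw [ha, hψx, hψ b hb] at hab
          exact absurd hab Sum.inr_ne_inl
      · by_cases hb : b = x
        · rw [hb, hψx, hψ a ha] at hab
          exact absurd hab Sum.inl_ne_inr
        · rw [hψ a ha, hψ b hb] at hab
          exact congrArg Subtype.val (φ.injective (Sum.inl_injective hab))

lemma nonempty_nestedTriangulation_one_one_iso :
    Nonempty (nestedTriangulation 1 1 ≃g (⊤ : SimpleGraph (Fin 4))) := by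
  have huniv : ∀ t : (nestedStage 1 0).NewTriangle, t.1 = (univ : Finset (Fin 3)) := fun t =>
    (card_eq_iff_eq_univ (α := Fin 3) t.1).mp (t.2.1.card_eq.trans (Fintype.card_fin 3).symm)
  have hsub : Subsingleton (nestedStage 1 0).NewTriangle :=
    ⟨fun t u => Subtype.ext ((huniv t).trans (huniv u).symm)⟩
  obtain ⟨t₀, -⟩ := exists_newTriangle_mem le_rfl 0 (0 : Fin 3)
  have hadj : ∀ x y : Fin 3 ⊕ (nestedStage 1 0).NewTriangle × Fin 1,
      (nestedTriangulation 1 1).Adj x y ↔ x ≠ y := by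
    rintro (a | t) (b | u)
    · exact Sum.inl_injective.ne_iff.symm
    · exact iff_of_true (show a ∈ u.1.1 by rw [huniv]; exact mem_univ a) Sum.inl_ne_inr
    · exact iff_of_true (show b ∈ t.1.1 by rw [huniv]; exact mem_univ b) Sum.inr_ne_inl
    · exact iff_of_false id fun h => h (congrArg _ (Subsingleton.elim _ _))
  let e : Fin 3 ⊕ (nestedStage 1 0).NewTriangle × Fin 1 ≃ Fin 4 :=
    (Equiv.sumCongr (Equiv.refl _) ⟨Prod.snd, fun k => (t₀, k),
      fun _ => Subsingleton.elim _ _, fun _ => rfl⟩).trans finSumFinEquiv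
  exact ⟨⟨e, fun {x y} => (e.injective.ne_iff (x := x) (y := y)).trans (hadj x y).symm⟩⟩

lemma nontrivial_nestedVertex (D N : ℕ) : Nontrivial (NestedVertex D N) := by
  induction D with
  | zero => exact inferInstanceAs (Nontrivial (Fin 3))
  | succ D ih =>
    exact Function.Injective.nontrivial
      (f := (Sum.inl : _ → NestedVertex D N ⊕ (nestedStage N D).NewTriangle × Fin N))
      Sum.inl_injective

theorem mainTheorem5 :
    (∀ D N : ℕ, 1 ≤ N → AldousHolds (nestedTriangulation D N)) ∧
    (Nonempty (nestedTriangulation 1 1 ≃g (⊤ : SimpleGraph (Fin 4))) ∧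
      ∀ (V : Type*) [Fintype V] [DecidableEq V] (G : SimpleGraph V),
        Fintype.card V = 4 → AldousHolds G) ∧
    (∀ (V : Type*) [Fintype V] [DecidableEq V] (G : SimpleGraph V),
      G.IsTree → 2 ≤ Fintype.card V →
        (∃ D N : ℕ, 1 ≤ N ∧ G.IsContained (nestedTriangulation D N)) ∧ AldousHolds G) := by
  refine ⟨fun D N _ => ?_, ⟨nonempty_nestedTriangulation_one_one_iso, fun V _ _ G hV => ?_⟩,
    fun V _ _ G hG hV => ⟨?_, hG.gapTransfersOn.aldousHolds hV⟩⟩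
  · have := nontrivial_nestedVertex D N
    exact GapTransfersOn.aldousHolds
      (@gapTransfersOn_nestedStage N D (fintypeNestedVertex D N) (decidableEqNestedVertex D N))
      (Fintype.one_lt_card (α := NestedVertex D N))
  · exact (gapTransfersOn_of_card_le_four G hV.le).aldousHolds (by omega)
  · obtain ⟨D, hD⟩ := hG.exists_isContained_nestedTriangulation
    exact ⟨D, 1, le_rfl, hD⟩
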